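/- Let $m\ge 1$ and let $a_1,\dots,a_m$ be non-zero integers. Let $D=D(a_1,\dots,a_m)$ be the standard diagram of a rational link: take the four-strand braid word, drawn from left to right, $$\sigma_1^{a_1}\sigma_2^{a_2}\sigma_1^{a_3}\sigma_2^{a_4}\cdots$$ with $m$ factors, alternately powers of $\sigma_1$ (strands $1,2$) and of $\sigma_2$ (strands $2,3$); join the left ends of the strands by caps $\{1,4\},\{2,3\}$ and the right ends by the caps $\{1,4\},\{2,3\}$ if $m$ is odd and $\{1,2\},\{3,4\}$ if $m$ is even. Here $\sigma_i$ is the crossing that is positive when both strands are oriented to the right, so that the $A$-smoothing of a crossing of an entry $a_i>0$, and the $B$-smoothing of a crossing of an entry $a_i<0$, consists of two arcs running in the direction of the twist. Assume: 1. No $a_i$ is equal to $1$. 2. There is an index $j$ with $a_j\ge 3$ whose neighbours are positive, that is, $a_{j-1}>0$ if $j>1$ and $a_{j+1}>0$ if $j<m$. 3. Every negative entry has only positive neighbours: if $a_i<0$, then $a_{i-1}>0$ if $i>1$ and $a_{i+1}>0$ if $i<m$. Then the link represented by $D$ has torsion of order two in its integral Khovanov homology: for some degrees $i,j$ the Khovanov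 homology group $\underline{Kh}^{i,j}(D)$, computed from the enhanced Kauffman states of $D$, contains an element of order two. Consequently, for every orientation of the link $L$, the group $Kh^{h,q}(L)=\underline{Kh}^{h+n,\,q-p+2n}(D)$, with $p$ and $n$ the numbers of positive and negative crossings, contains an element of order two for some $h,q$. -/

import Mathlib

/-!
Link diagrams, Khovanov homology over `ℤ` (Viro's enhanced states), and the standard diagrams of
rational links.
-/

/-- A link diagram, given combinatorially. The link projection is cut at finitely many points `Pt`
into pieces: a small disc around each of the `n` (numbered) crossings, which meets the projection
in a cross with the four ends `corner c 0, …, corner c 3`, and the segments between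
points that are adjacent in `arc`. The corners of a crossing are listed counterclockwise, and the
strand from corner `0` to corner `2` passes **under** the strand from corner `1` to corner `3`.
Each point is the end of exactly two pieces. (Two crossings may share a point, as in a PD code.) -/
structure LinkDiagram where
  n : ℕ
  Pt : Type
  [fintypePt : Fintype Pt]
  corner : Fin n → Fin 4 → Pt
  arc : SimpleGraph Pt
  two_ends : ∀ x : Pt,
    {q : Fin n × Fin 4 | corner q.1 q.2 = x}.ncard + (arc.neighborSet x).ncard = 2

namespace LinkDiagram

/-- The two ways to smooth a crossing. -/
inductive Label
  | A
  | B
  deriving DecidableEq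

/-- The two signs that a circle of an enhanced state may carry. -/
inductive Sign
  | plus
  | minus
  deriving DecidableEq

variable (D : LinkDiagram)

/-- A Kauffman state: an `A`- or a `B`-label at each crossing. -/
abbrev State : Type := Fin D.n → Label

/-- Corners `k` and `l` of a crossing are joined by the `A`-smoothing (the channel that it opens
consists of the regions swept out by the over-strand when turned counterclockwise), resp. by the
`B`-smoothing. -/
def smoothed : Label → Fin 4 → Fin 4 → Prop
  | Label.A, k, l => (k = 0 ∧ l = 1) ∨ (k = 2 ∧ l = 3)
  | Label.B, k, l => (k = 1 ∧ l = 2) ∨ (k = 3 ∧ l = 0)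

variable {D} in
/-- The result of smoothing all crossings according to the state `s`. -/
def smoothing (s : D.State) : SimpleGraph D.Pt :=
  D.arc ⊔ SimpleGraph.fromRel
    (fun x y => ∃ c k l, smoothed (s c) k l ∧ D.corner c k = x ∧ D.corner c l = y)

variable {D} in
/-- The circles of `sD`. -/
abbrev Circle (s : D.State) : Type := (smoothing s).ConnectedComponent

/-- An enhanced state: a Kauffman state with a sign on each of its circles. -/
structure EnhancedState where
  state : D.State
  sign : Circle state → Sign

namespace EnhancedState

variable {D}

/-- The homological degree `i(s)`: the number of `B`-labels. -/
noncomputable def hdeg (s : D.EnhancedState) : ℤ :=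
  ({c | s.state c = Label.B}.ncard : ℤ)

/-- `θ(s)`: the number of circles with sign `+` minus the number of circles with sign `-`. -/
noncomputable def theta (s : D.EnhancedState) : ℤ :=
  ({C | s.sign C = Sign.plus}.ncard : ℤ) - ({C | s.sign C = Sign.minus}.ncard : ℤ)

/-- The quantum degree `j(s) = i(s) + θ(s)`. -/
noncomputable def qdeg (s : D.EnhancedState) : ℤ := s.hdeg + s.theta

/-- `t` is adjacent to `s` with change crossing `x`: the label at `x` changes from `A` to `B`, all
other labels agree, the quantum degrees agree, and the circles that `sD` and `tD` have in common
carry the same signs. -/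
def AdjacentAt (x : Fin D.n) (s t : D.EnhancedState) : Prop :=
  s.state x = Label.A ∧ t.state = Function.update s.state x Label.B ∧
    t.hdeg = s.hdeg + 1 ∧ t.qdeg = s.qdeg ∧
    ∀ (C : Circle s.state) (C' : Circle t.state), C.supp = C'.supp → s.sign C = t.sign C'

open Classical in
/-- The incidence number of `s` over `t`: it is `(-1)^k` if `t` is adjacent to `s`, where `k` is the
number of `B`-labels of `s` previous to the change crossing, and `0` otherwise. (At most one
summand is non-zero.) -/
noncomputable def incidence (s t : D.EnhancedState) : ℤ :=
  ∑ x : Fin D.n, if AdjacentAt x s t then (-1) ^ {y | y < x ∧ s.state y = Label.B}.ncard else 0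

end EnhancedState

instance instFinitePt : Finite D.Pt := @Finite.of_fintype _ D.fintypePt

instance instFiniteEnhancedState : Finite D.EnhancedState := by
  have : Finite Label := Finite.of_surjective (fun b : Bool => if b then Label.A else Label.B)
    (fun l => by cases l; exacts [⟨true, rfl⟩, ⟨false, rfl⟩])
  have : Finite Sign := Finite.of_surjective (fun b : Bool => if b then Sign.plus else Sign.minus)
    (fun l => by cases l; exacts [⟨true, rfl⟩, ⟨false, rfl⟩])
  have : ∀ s : D.State, Finite (Circle s) := fun s =>
    Finite.of_surjective (smoothing s).connectedComponentMk (fun C => C.exists_rep)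
  refine Finite.of_injective
    (β := Σ s : D.State, (Circle s → Sign)) (fun s => ⟨s.state, s.sign⟩) ?_
  rintro ⟨s, e⟩ ⟨t, f⟩ h
  simp only [Sigma.mk.injEq] at h
  obtain ⟨rfl, h⟩ := h
  rw [eq_of_heq h]

/-- The free abelian group `C(D)` on all enhanced states of `D`. -/
abbrev Chain : Type := D.EnhancedState →₀ ℤ

/-- The summand `C^{i,j}(D)`, generated by the enhanced states of degrees `i` and `j`. -/
noncomputable def chainsOfDegree (i j : ℤ) : Submodule ℤ D.Chain :=
  Finsupp.supported ℤ ℤ {s | s.hdeg = i ∧ s.qdeg = j}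

/-- The differential `d(s) = ∑ₜ i(s,t) t`. -/
noncomputable def differential : D.Chain →ₗ[ℤ] D.Chain :=
  Finsupp.linearCombination ℤ (fun s => Finsupp.equivFunOnFinite.symm (fun t => s.incidence t))

/-- The kernel of `d` on `C^{i,j}(D)`. -/
noncomputable def cycles (i j : ℤ) : Submodule ℤ D.Chain :=
  D.chainsOfDegree i j ⊓ LinearMap.ker D.differential

/-- The image of `C^{i-1,j}(D)` under `d`. -/
noncomputable def boundaries (i j : ℤ) : Submodule ℤ D.Chain :=
  (D.chainsOfDegree (i - 1) j).map D.differential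

/-- The Khovanov homology of the diagram `D` for the degrees `i` and `j`, over `ℤ`. -/
abbrev KhDiagram (i j : ℤ) : Type :=
  D.cycles i j ⧸ (D.boundaries i j).submoduleOf (D.cycles i j)

/-- An orientation of the link: it says which corners of each crossing point towards the crossing.
Each of the two strands at a crossing enters at one corner and leaves at the opposite one, and a
strand that joins two corners outside the crossings leaves the one and enters at the other. -/
structure Orientation where
  inward : Fin D.n → Fin 4 → Bool
  through : ∀ c k, inward c (k + 2) = !inward c k
  along : ∀ c k c' k', (c, k) ≠ (c', k') →
    D.arc.Reachable (D.corner c k) (D.corner c' k') → inward c k = !inward c' k'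

/-- The number `p` of positive crossings. -/
noncomputable def Orientation.positive {D : LinkDiagram} (o : D.Orientation) : ℕ :=
  {c | o.inward c 0 = o.inward c 3}.ncard

/-- The number of negative crossings. -/
noncomputable def Orientation.negative {D : LinkDiagram} (o : D.Orientation) : ℕ :=
  {c | o.inward c 0 ≠ o.inward c 3}.ncard

/-- The Khovanov homology `Kh^{h,q}(L)` of the oriented link `L` that is represented by `D` with the
orientation `o`. -/
abbrev Kh (o : D.Orientation) (h q : ℤ) : Type :=
  D.KhDiagram (h + o.negative) (q - o.positive + 2 * o.negative)

end LinkDiagram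

/-! ### Rational links -/

namespace RationalLink

/-- A crossing of two neighbouring strands of a four-strand braid that is drawn from left to
right. The strands are numbered `0, 1, 2, 3` from bottom to top and the crossing is between the
strands `pos` and `pos + 1`. With both strands oriented to the right it is a positive crossing
if `positive` is true and a negative one otherwise. -/
structure BraidCrossing where
  pos : Fin 3
  positive : Bool

/-- The strand `s` takes part in the crossing. -/
def BraidCrossing.Touches (g : BraidCrossing) (s : Fin 4) : Prop :=
  s = g.pos.castSucc ∨ s = g.pos.succ

/-- The corners, counterclockwise with `0` and `2` on the under-strand, of a crossing between the
levels `t` and `t + 1`. At a positive crossing the strand from the lower left to the upper right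
is under the other one, at a negative crossing it is over. -/
def braidCorner {N : ℕ} (g : BraidCrossing) (t : Fin (N + 1)) :
    Fin 4 → Fin (N + 2) × Fin 4 :=
  if g.positive then
    ![(t.castSucc, g.pos.castSucc), (t.succ, g.pos.castSucc),
      (t.succ, g.pos.succ), (t.castSucc, g.pos.succ)]
  else
    ![(t.succ, g.pos.castSucc), (t.succ, g.pos.succ),
      (t.castSucc, g.pos.succ), (t.castSucc, g.pos.castSucc)]

/-- Arcs that join the ends of four strands in pairs: `0` with `3` and `1` with `2`. -/
def outerCaps : Fin 4 → Fin 4 := ![3, 2, 1, 0]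

/-- Arcs that join the ends of four strands in pairs: `0` with `1` and `2` with `3`. -/
def sideCaps : Fin 4 → Fin 4 := ![1, 0, 3, 2]

/-- The crossingless pieces of the plat closure of the braid word `w`, of length `N`: the point
`(t, s)` is the point of strand `s` on the vertical line number `t`, `0 ≤ t ≤ N + 1`. The
crossing number `t` is between the lines `t` and `t + 1`, and there is none between the
lines `N` and `N + 1`. The left ends of the strands are joined by `outerCaps`, the right ends
by `cap`. -/
def platArc (w : List BraidCrossing) (cap : Fin 4 → Fin 4) :
    SimpleGraph (Fin (w.length + 2) × Fin 4) :=
  SimpleGraph.fromRel fun P Q =>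
    (Q.1.val = P.1.val + 1 ∧ Q.2 = P.2 ∧
      ∀ h : P.1.val < w.length, ¬ (w[P.1.val]).Touches P.2) ∨
    (P.1 = 0 ∧ Q.1 = 0 ∧ Q.2 = outerCaps P.2) ∨
    (P.1 = Fin.last _ ∧ Q.1 = Fin.last _ ∧ Q.2 = cap P.2)


theorem exists_leftCorner (g : BraidCrossing) (s : Fin 4) (hs : g.Touches s) :
    ∃ k₀ : Fin 4, ∀ (N : ℕ) (c : Fin (N + 1)) (t : Fin (N + 2)) (k : Fin 4), c.val = t.val →
      (braidCorner g c k = (t, s) ↔ k = k₀) := by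
  obtain ⟨p, b⟩ := g
  refine ⟨if b then (if s = p.castSucc then 0 else 3) else (if s = p.castSucc then 3 else 2), ?_⟩
  intro N c t k h
  revert hs
  fin_cases p <;> cases b <;> fin_cases s <;> fin_cases k <;>
    simp [braidCorner, BraidCrossing.Touches, Prod.ext_iff, Fin.ext_iff] <;> omega

theorem exists_rightCorner (g : BraidCrossing) (s : Fin 4) (hs : g.Touches s) :
    ∃ k₀ : Fin 4, ∀ (N : ℕ) (c : Fin (N + 1)) (t : Fin (N + 2)) (k : Fin 4), c.val + 1 = t.val →
      (braidCorner g c k = (t, s) ↔ k = k₀) := by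
  obtain ⟨p, b⟩ := g
  refine ⟨if b then (if s = p.castSucc then 1 else 2) else (if s = p.castSucc then 0 else 1), ?_⟩
  intro N c t k h
  revert hs
  fin_cases p <;> cases b <;> fin_cases s <;> fin_cases k <;>
    simp [braidCorner, BraidCrossing.Touches, Prod.ext_iff, Fin.ext_iff] <;> omega

theorem braidCorner_touches {N : ℕ} (g : BraidCrossing) (c : Fin (N + 1)) (k : Fin 4)
    (t : Fin (N + 2)) (s : Fin 4) (h : braidCorner g c k = (t, s)) :
    g.Touches s ∧ (c.val = t.val ∨ c.val + 1 = t.val) := by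
  obtain ⟨p, b⟩ := g
  cases b <;> fin_cases k <;>
    simp [braidCorner, BraidCrossing.Touches, Prod.ext_iff, Fin.ext_iff] at h ⊢ <;> omega

/-- The corners of the crossings of a braid word. -/
def platCorner (w : List BraidCrossing) (c : Fin w.length) (k : Fin 4) :
    Fin (w.length + 2) × Fin 4 :=
  braidCorner w[c] c.castSucc k

theorem plat_right_end (w : List BraidCrossing) (cap : Fin 4 → Fin 4)
    (t : Fin (w.length + 2)) (s : Fin 4) :
    {q : Fin w.length × Fin 4 | q.1.val = t.val ∧ platCorner w q.1 q.2 = (t, s)}.ncard +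
    {y : Fin (w.length + 2) × Fin 4 | (y.1.val = t.val + 1 ∧ y.2 = s ∧
      ∀ h : t.val < w.length, ¬ (w[t.val]).Touches s) ∨
      (t = Fin.last _ ∧ y.1 = Fin.last _ ∧ y.2 = cap s)}.ncard = 1 := by
  by_cases h : ∃ h : t.val < w.length, (w[t.val]).Touches s
  · obtain ⟨h, ht⟩ := h
    obtain ⟨k₀, hk⟩ := exists_leftCorner _ _ ht
    rw [show {q : Fin w.length × Fin 4 | q.1.val = t.val ∧ platCorner w q.1 q.2 = (t, s)}
        = {(⟨t.val, h⟩, k₀)} from ?_, show {y : Fin (w.length + 2) × Fin 4 | _} = ∅ from ?_]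
    · simp
    · ext y
      simp only [Set.mem_ofPred_eq, Set.mem_empty_iff_false, iff_false]
      rintro (⟨_, _, h'⟩ | ⟨h', _⟩)
      · exact h' h ht
      · rw [h', Fin.val_last] at h
        omega
    · ext ⟨c, k⟩
      simp only [Set.mem_ofPred_eq, Set.mem_singleton_iff, Prod.mk.injEq, Fin.ext_iff (a := c)]
      constructor
      · rintro ⟨hc, hq⟩
        obtain rfl : c = ⟨t.val, h⟩ := Fin.ext hc
        exact ⟨rfl, (hk _ _ t k (by simp)).1 hq⟩
      · rintro ⟨hc, hq⟩
        obtain rfl : c = ⟨t.val, h⟩ := Fin.ext hc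
        exact ⟨rfl, (hk _ _ t k (by simp)).2 hq⟩
  · rw [show {q : Fin w.length × Fin 4 | q.1.val = t.val ∧ platCorner w q.1 q.2 = (t, s)}
        = ∅ from ?_]
    · rw [Set.ncard_empty, zero_add, Set.ncard_eq_one]
      by_cases hl : t = Fin.last _
      · refine ⟨(Fin.last _, cap s), ?_⟩
        ext ⟨u, v⟩
        simp only [Set.mem_ofPred_eq, Set.mem_singleton_iff, Prod.mk.injEq]
        have := u.isLt
        have h2 : t.val = w.length + 1 := by rw [hl]; simp
        constructor
        · rintro (h' | h')
          · omega
          · exact h'.2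
        · exact fun h' => Or.inr ⟨hl, h'⟩
      · have h2 : t.val < w.length + 1 := by
          have := t.isLt
          have h3 : t.val ≠ w.length + 1 := fun h => hl (Fin.ext (by simpa using h))
          omega
        refine ⟨(⟨t.val + 1, by omega⟩, s), ?_⟩
        ext ⟨u, v⟩
        simp only [Set.mem_ofPred_eq, Set.mem_singleton_iff, Prod.mk.injEq, Fin.ext_iff (a := u)]
        constructor
        · rintro (h' | h')
          · exact ⟨h'.1, h'.2.1⟩
          · exact absurd h'.1 hl
        · exact fun h' => Or.inl ⟨h'.1, h'.2, fun a b => h ⟨a, b⟩⟩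
    · ext ⟨c, k⟩
      simp only [Set.mem_ofPred_eq, Set.mem_empty_iff_false, iff_false]
      rintro ⟨hc, hq⟩
      have h1 := (braidCorner_touches _ _ _ _ _ hq).1
      refine h ⟨by omega, ?_⟩
      simpa [← hc] using h1

theorem plat_left_end (w : List BraidCrossing) (t : Fin (w.length + 2)) (s : Fin 4) :
    {q : Fin w.length × Fin 4 | q.1.val + 1 = t.val ∧ platCorner w q.1 q.2 = (t, s)}.ncard +
    {y : Fin (w.length + 2) × Fin 4 | (t.val = y.1.val + 1 ∧ y.2 = s ∧
      ∀ h : y.1.val < w.length, ¬ (w[y.1.val]).Touches s) ∨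
      (t = 0 ∧ y.1 = 0 ∧ y.2 = outerCaps s)}.ncard = 1 := by
  by_cases h : ∃ h : t.val - 1 < w.length, t.val ≠ 0 ∧ (w[t.val - 1]).Touches s
  · obtain ⟨h, h0, ht⟩ := h
    obtain ⟨k₀, hk⟩ := exists_rightCorner _ _ ht
    rw [show {q : Fin w.length × Fin 4 | q.1.val + 1 = t.val ∧ platCorner w q.1 q.2 = (t, s)}
        = {(⟨t.val - 1, h⟩, k₀)} from ?_, show {y : Fin (w.length + 2) × Fin 4 | _} = ∅ from ?_]
    · simp
    · ext ⟨u, v⟩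
      simp only [Set.mem_ofPred_eq, Set.mem_empty_iff_false, iff_false]
      rintro (⟨h1, _, h'⟩ | ⟨h', _⟩)
      · have h2 : u.val = t.val - 1 := by omega
        simp only [h2] at h'
        exact h' h ht
      · exact h0 (by simp [h'])
    · ext ⟨c, k⟩
      simp only [Set.mem_ofPred_eq, Set.mem_singleton_iff, Prod.mk.injEq, Fin.ext_iff (a := c)]
      constructor
      · rintro ⟨hc, hq⟩
        obtain rfl : c = ⟨t.val - 1, h⟩ := Fin.ext (by simp; omega)
        exact ⟨rfl, (hk _ _ t k (by simp; omega)).1 hq⟩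
      · rintro ⟨hc, hq⟩
        obtain rfl : c = ⟨t.val - 1, h⟩ := Fin.ext hc
        exact ⟨by simp; omega, (hk _ _ t k (by simp; omega)).2 hq⟩
  · rw [show {q : Fin w.length × Fin 4 | q.1.val + 1 = t.val ∧ platCorner w q.1 q.2 = (t, s)}
        = ∅ from ?_]
    · rw [Set.ncard_empty, zero_add, Set.ncard_eq_one]
      by_cases hl : t = 0
      · refine ⟨(0, outerCaps s), ?_⟩
        ext ⟨u, v⟩
        simp only [Set.mem_ofPred_eq, Set.mem_singleton_iff, Prod.mk.injEq]
        have h2 : t.val = 0 := by rw [hl]; simp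
        constructor
        · rintro (h' | h')
          · omega
          · exact h'.2
        · exact fun h' => Or.inr ⟨hl, h'⟩
      · have h2 : t.val ≠ 0 := fun h => hl (Fin.ext (by simpa using h))
        refine ⟨(⟨t.val - 1, by omega⟩, s), ?_⟩
        ext ⟨u, v⟩
        simp only [Set.mem_ofPred_eq, Set.mem_singleton_iff, Prod.mk.injEq, Fin.ext_iff (a := u)]
        constructor
        · rintro (h' | h')
          · exact ⟨by omega, h'.2.1⟩
          · exact absurd h'.1 hl
        · rintro ⟨h3, h4⟩
          refine Or.inl ⟨by omega, h4, fun a b => h ⟨by omega, h2, ?_⟩⟩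
          simpa only [h3] using b
    · ext ⟨c, k⟩
      simp only [Set.mem_ofPred_eq, Set.mem_empty_iff_false, iff_false]
      rintro ⟨hc, hq⟩
      have h1 := (braidCorner_touches _ _ _ _ _ hq).1
      refine h ⟨by omega, by omega, ?_⟩
      have h2 : t.val - 1 = c.val := by omega
      simpa [h2] using h1

/-- The plat closure of a braid word `w` on four strands. The left ends are joined by
`outerCaps`, the right ends by `cap`, which has to be an involution without fixed points. -/
def plat (w : List BraidCrossing) (cap : Fin 4 → Fin 4)
    (hcap : ∀ s, cap (cap s) = s) (hcap' : ∀ s, cap s ≠ s) : LinkDiagram where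
  n := w.length
  Pt := Fin (w.length + 2) × Fin 4
  corner := platCorner w
  arc := platArc w cap
  two_ends := by
    rintro ⟨t, s⟩
    have hR := plat_right_end w cap t s
    have hL := plat_left_end w t s
    have e1 : {q : Fin w.length × Fin 4 | platCorner w q.1 q.2 = (t, s)} =
        {q | q.1.val = t.val ∧ platCorner w q.1 q.2 = (t, s)} ∪
        {q | q.1.val + 1 = t.val ∧ platCorner w q.1 q.2 = (t, s)} := by
      ext ⟨c, k⟩
      simp only [Set.mem_ofPred_eq, Set.mem_union]
      constructor
      · intro h
        rcases (braidCorner_touches _ _ _ _ _ h).2 with h' | h'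
        · exact Or.inl ⟨by simpa using h', h⟩
        · exact Or.inr ⟨by simpa using h', h⟩
      · rintro (h | h) <;> exact h.2
    have e2 : (platArc w cap).neighborSet (t, s) =
        {y | (y.1.val = t.val + 1 ∧ y.2 = s ∧
          ∀ h : t.val < w.length, ¬ (w[t.val]).Touches s) ∨
          (t = Fin.last _ ∧ y.1 = Fin.last _ ∧ y.2 = cap s)} ∪
        {y | (t.val = y.1.val + 1 ∧ y.2 = s ∧
          ∀ h : y.1.val < w.length, ¬ (w[y.1.val]).Touches s) ∨
          (t = 0 ∧ y.1 = 0 ∧ y.2 = outerCaps s)} := by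
      have ho : ∀ s, outerCaps (outerCaps s) = s := by decide
      have ho' : ∀ s, outerCaps s ≠ s := by decide
      ext ⟨u, v⟩
      simp only [SimpleGraph.mem_neighborSet, platArc, SimpleGraph.fromRel_adj,
        Set.mem_ofPred_eq, Set.mem_union]
      constructor
      · rintro ⟨_, ((h | h | h) | (⟨h1, h2, h3⟩ | ⟨h1, h2, h3⟩ | ⟨h1, h2, h3⟩))⟩
        · exact Or.inl (Or.inl h)
        · exact Or.inr (Or.inr h)
        · exact Or.inl (Or.inr h)
        · subst h2
          exact Or.inr (Or.inl ⟨h1, rfl, h3⟩)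
        · exact Or.inr (Or.inr ⟨h2, h1, by rw [h3, ho]⟩)
        · exact Or.inl (Or.inr ⟨h2, h1, by rw [h3, hcap]⟩)
      · rintro ((⟨h1, h2, h3⟩ | ⟨h1, h2, h3⟩) | (⟨h1, h2, h3⟩ | ⟨h1, h2, h3⟩))
        · refine ⟨fun h => ?_, Or.inl (Or.inl ⟨h1, h2, h3⟩)⟩
          simp only [Prod.mk.injEq] at h
          rw [h.1] at h1
          omega
        · refine ⟨fun h => hcap' s ?_, Or.inl (Or.inr (Or.inr ⟨h1, h2, h3⟩))⟩
          simp only [Prod.mk.injEq] at h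
          rw [← h3, ← h.2]
        · subst h2
          refine ⟨fun h => ?_, Or.inr (Or.inl ⟨h1, rfl, h3⟩)⟩
          simp only [Prod.mk.injEq] at h
          rw [h.1] at h1
          omega
        · refine ⟨fun h => ho' s ?_, Or.inl (Or.inr (Or.inl ⟨h1, h2, h3⟩))⟩
          simp only [Prod.mk.injEq] at h
          rw [← h3, ← h.2]
    have d1 : Disjoint
        {q : Fin w.length × Fin 4 | q.1.val = t.val ∧ platCorner w q.1 q.2 = (t, s)}
        {q | q.1.val + 1 = t.val ∧ platCorner w q.1 q.2 = (t, s)} := by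
      rw [Set.disjoint_left]
      rintro q ⟨h, _⟩ ⟨h', _⟩
      omega
    have d2 : Disjoint
        {y : Fin (w.length + 2) × Fin 4 | (y.1.val = t.val + 1 ∧ y.2 = s ∧
          ∀ h : t.val < w.length, ¬ (w[t.val]).Touches s) ∨
          (t = Fin.last _ ∧ y.1 = Fin.last _ ∧ y.2 = cap s)}
        {y | (t.val = y.1.val + 1 ∧ y.2 = s ∧
          ∀ h : y.1.val < w.length, ¬ (w[y.1.val]).Touches s) ∨
          (t = 0 ∧ y.1 = 0 ∧ y.2 = outerCaps s)} := by
      rw [Set.disjoint_left]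
      rintro ⟨u, v⟩ (⟨h, _⟩ | ⟨h, h1, _⟩) (⟨h', _⟩ | ⟨h', h2, _⟩)
      · simp only at h h'
        omega
      · simp only at h h2
        rw [h2] at h
        simp at h
      · simp only at h' h1
        rw [h, h1] at h'
        simp at h'
      · rw [h] at h'
        simp [Fin.ext_iff] at h'
    rw [e1, e2, Set.ncard_union_eq d1 (Set.toFinite _) (Set.toFinite _),
      Set.ncard_union_eq d2 (Set.toFinite _) (Set.toFinite _)]
    omega

/-- The four-strand braid of the standard rational diagram: `|aᵢ|` crossings for each entry, which
are of the same sign as `aᵢ`; for the first, third, fifth, … entry they are crossings of the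
strands `0` and `1`, for the other entries crossings of the strands `1` and `2`. -/
def braidWord {m : ℕ} (a : Fin m → ℤ) : List BraidCrossing :=
  (List.finRange m).flatMap fun i =>
    List.replicate (a i).natAbs ⟨if Even i.val then 0 else 1, decide (0 < a i)⟩

/-- The standard diagram `D(a₁, …, aₘ)` of a rational link. The right ends of the braid are closed
such that the last twists cannot be undone by turning the caps. -/
def diagram {m : ℕ} (a : Fin m → ℤ) : LinkDiagram :=
  plat (braidWord a) (if Even m then sideCaps else outerCaps)
    (by split_ifs <;> decide) (by split_ifs <;> decide)

end RationalLink

namespace LinkDiagram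

variable {D : LinkDiagram}

/-- A union of pieces of the projection that is closed under all pieces other than the crossing `x`
contains an even number of corners of `x`. -/
theorem even_ncard_corner_mem (s : D.State) (x : Fin D.n) (K : Set D.Pt)
    (harc : ∀ p q, D.arc.Adj p q → p ∈ K → q ∈ K)
    (hcr : ∀ c k l, c ≠ x → smoothed (s c) k l → (D.corner c k ∈ K ↔ D.corner c l ∈ K)) :
    Even {k | D.corner x k ∈ K}.ncard := by
  classical
  let _ := D.fintypePt
  have hdeg : Even (∑ p ∈ K.toFinset, (D.arc.neighborSet p).ncard) := by
    have h := (D.arc.induce K).sum_degrees_eq_twice_card_edges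
    rw [← Finset.sum_coe_sort]
    refine ⟨(D.arc.induce K).edgeFinset.card, ?_⟩
    rw [← two_mul, ← h]
    refine Fintype.sum_equiv (Equiv.subtypeEquivRight (by simp)) _ _ ?_
    rintro ⟨p, hp⟩
    rw [← SimpleGraph.card_neighborSet_eq_degree, ← Set.toFinset_card, ← Set.ncard_eq_toFinset_card']
    have hp' : p ∈ K := by simpa using hp
    have : D.arc.neighborSet p = Subtype.val '' ((D.arc.induce K).neighborSet ⟨p, hp'⟩) := by
      ext q
      simp only [SimpleGraph.mem_neighborSet, Set.mem_image, Subtype.exists,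
        SimpleGraph.comap_adj, Function.Embedding.subtype_apply, exists_and_right, exists_eq_right]
      exact ⟨fun h => ⟨harc _ _ h hp', h⟩, fun h => h.2⟩
    change (D.arc.neighborSet p).ncard = _
    rw [this, Set.ncard_image_of_injective _ Subtype.val_injective]
    rfl
  have hsum : ∑ p ∈ K.toFinset, {q : Fin D.n × Fin 4 | D.corner q.1 q.2 = p}.ncard
      = ∑ c, {k | D.corner c k ∈ K}.ncard := by
    have h1 : ∀ p, {q : Fin D.n × Fin 4 | D.corner q.1 q.2 = p}.ncard
        = ∑ c, ∑ k, if D.corner c k = p then 1 else 0 := by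
      intro p
      rw [← Fintype.sum_prod_type', Set.ncard_eq_toFinset_card', Finset.sum_boole]
      simp
    have h2 : ∀ c, {k | D.corner c k ∈ K}.ncard
        = ∑ k, if D.corner c k ∈ K then 1 else 0 := by
      intro c
      rw [Set.ncard_eq_toFinset_card', Finset.sum_boole]
      simp
    simp only [h1, h2]
    rw [Finset.sum_comm]
    refine Finset.sum_congr rfl fun c _ => ?_
    rw [Finset.sum_comm]
    refine Finset.sum_congr rfl fun k _ => ?_
    simp
  have htot : Even (∑ c, {k | D.corner c k ∈ K}.ncard) := by
    have h : ∑ p ∈ K.toFinset, ({q : Fin D.n × Fin 4 | D.corner q.1 q.2 = p}.ncard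
        + (D.arc.neighborSet p).ncard) = ∑ p ∈ K.toFinset, 2 :=
      Finset.sum_congr rfl fun p _ => D.two_ends p
    rw [Finset.sum_add_distrib, hsum] at h
    have h2 : Even (∑ p ∈ K.toFinset, 2) := by simp
    rw [← h] at h2
    exact (Nat.even_add.1 h2).2 hdeg
  rw [← Finset.add_sum_erase _ _ (Finset.mem_univ x)] at htot
  refine (Nat.even_add.1 htot).2 (Finset.even_sum _ fun c hc => ?_)
  have hc' := Finset.ne_of_mem_erase hc
  rw [Set.ncard_eq_toFinset_card', show ({k | D.corner c k ∈ K} : Set (Fin 4)).toFinset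
    = Finset.univ.filter (fun k => D.corner c k ∈ K) by ext; simp,
    Finset.card_filter, Fin.sum_univ_four]
  rcases hs : s c with _ | _
  · have h1 := hcr c 0 1 hc' (by rw [hs]; simp [smoothed])
    have h2 := hcr c 2 3 hc' (by rw [hs]; simp [smoothed])
    simp only [h1, h2]
    split_ifs <;> decide
  · have h1 := hcr c 1 2 hc' (by rw [hs]; simp [smoothed])
    have h2 := hcr c 3 0 hc' (by rw [hs]; simp [smoothed])
    simp only [h1, h2]
    split_ifs <;> decide

theorem smoothing_adj {s : D.State} {p q : D.Pt} :
    (smoothing s).Adj p q ↔ D.arc.Adj p q ∨ p ≠ q ∧ ∃ c k l,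
      (smoothed (s c) k l ∨ smoothed (s c) l k) ∧ D.corner c k = p ∧ D.corner c l = q := by
  simp only [smoothing, SimpleGraph.sup_adj, SimpleGraph.fromRel_adj]
  refine or_congr_right (and_congr_right fun _ => ⟨?_, ?_⟩)
  · rintro (⟨c, k, l, h, h1, h2⟩ | ⟨c, k, l, h, h1, h2⟩)
    exacts [⟨c, k, l, Or.inl h, h1, h2⟩, ⟨c, l, k, Or.inr h, h2, h1⟩]
  · rintro ⟨c, k, l, h | h, h1, h2⟩
    exacts [Or.inl ⟨c, k, l, h, h1, h2⟩, Or.inr ⟨c, l, k, h, h2, h1⟩]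

theorem reachable_of_smoothed {s : D.State} {c : Fin D.n} {k l : Fin 4} (h : smoothed (s c) k l) :
    (smoothing s).Reachable (D.corner c k) (D.corner c l) := by
  by_cases hpq : D.corner c k = D.corner c l
  · rw [hpq]
  · exact (smoothing_adj.2 (Or.inr ⟨hpq, c, k, l, Or.inl h, rfl, rfl⟩)).reachable

theorem rel_of_reachable {V : Type*} {G : SimpleGraph V} {r : V → V → Prop} (hr : Equivalence r)
    (h : ∀ p q, G.Adj p q → r p q) {p q : V} (hpq : G.Reachable p q) : r p q := by
  obtain ⟨w⟩ := hpq
  induction w with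
  | nil => exact hr.refl _
  | cons h' _ ih => exact hr.trans (h _ _ h') ih

/-- An equivalence relation that holds along the pieces of a smoothing holds along its circles. -/
theorem rel_of_smoothing_reachable {s : D.State} {r : D.Pt → D.Pt → Prop} (hr : Equivalence r)
    (harc : ∀ p q, D.arc.Adj p q → r p q)
    (hcr : ∀ c k l, smoothed (s c) k l → r (D.corner c k) (D.corner c l))
    {p q : D.Pt} (hpq : (smoothing s).Reachable p q) : r p q := by
  refine rel_of_reachable hr (fun p q h => ?_) hpq
  rcases smoothing_adj.1 h with h | ⟨_, c, k, l, h' | h', rfl, rfl⟩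
  exacts [harc _ _ h, hcr _ _ _ h', hr.symm (hcr _ _ _ h')]

/-- `x` is a crossing with label `A` in `s`, and it joins two different circles of the state
obtained by changing its label to `B`. -/
structure Splits (s : D.State) (x : Fin D.n) : Prop where
  label : s x = Label.A
  separated : ¬ (smoothing (Function.update s x Label.B)).Reachable (D.corner x 0) (D.corner x 1)

/-- The circles of a diagram that is cut open at the crossing `x`, as an equivalence relation. -/
def AwayRel (s : D.State) (x : Fin D.n) (p q : D.Pt) : Prop :=
  Relation.EqvGen (fun p q => D.arc.Adj p q ∨
    ∃ c k l, c ≠ x ∧ smoothed (s c) k l ∧ D.corner c k = p ∧ D.corner c l = q) p q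

theorem awayRel_update (s : D.State) (x : Fin D.n) (l : Label) :
    AwayRel (Function.update s x l) x = AwayRel s x := by
  have h : ∀ (p q : D.Pt) c k k', (c ≠ x ∧ smoothed (Function.update s x l c) k k' ∧
      D.corner c k = p ∧ D.corner c k' = q) ↔
      (c ≠ x ∧ smoothed (s c) k k' ∧ D.corner c k = p ∧ D.corner c k' = q) := fun p q c k k' =>
    and_congr_right fun hc => by rw [Function.update_of_ne hc]
  unfold AwayRel
  simp only [h]

theorem AwayRel.reachable {s : D.State} {x : Fin D.n} {p q : D.Pt} (h : AwayRel s x p q) :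
    (smoothing s).Reachable p q := by
  induction h with
  | rel p q h =>
    rcases h with h | ⟨c, k, l, _, h, rfl, rfl⟩
    · exact (smoothing_adj.2 (Or.inl h)).reachable
    · exact reachable_of_smoothed h
  | refl => exact .refl _
  | symm _ _ _ ih => exact ih.symm
  | trans _ _ _ _ _ ih1 ih2 => exact ih1.trans ih2

theorem even_ncard_corner_awayRel (s : D.State) (x : Fin D.n) (p : D.Pt) :
    Even {k | AwayRel s x p (D.corner x k)}.ncard := by
  refine even_ncard_corner_mem s x {q | AwayRel s x p q} (fun q r h hq => ?_)
    (fun c k l hc h => ?_)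
  · exact Relation.EqvGen.trans _ _ _ hq (.rel _ _ (Or.inl h))
  · have h' : AwayRel s x (D.corner c k) (D.corner c l) :=
      .rel _ _ (Or.inr ⟨c, k, l, hc, h, rfl, rfl⟩)
    exact ⟨fun hq => .trans _ _ _ hq h', fun hq => .trans _ _ _ hq (.symm _ _ h')⟩

namespace Splits

variable {s : D.State} {x : Fin D.n} (h : Splits s x)

include h in
theorem awayRel_corners : AwayRel s x (D.corner x 1) (D.corner x 2) ∧
    AwayRel s x (D.corner x 0) (D.corner x 3) := by
  have hr : ∀ {p q}, AwayRel s x p q →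
      (smoothing (Function.update s x Label.B)).Reachable p q := fun {p q} hpq => by
    rw [← awayRel_update s x Label.B] at hpq
    exact hpq.reachable
  have h12 : (smoothing (Function.update s x Label.B)).Reachable (D.corner x 1) (D.corner x 2) :=
    reachable_of_smoothed (by simp [smoothed])
  have h30 : (smoothing (Function.update s x Label.B)).Reachable (D.corner x 3) (D.corner x 0) :=
    reachable_of_smoothed (by simp [smoothed])
  constructor
  · by_contra h2
    have he := even_ncard_corner_awayRel s x (D.corner x 1)
    rw [show {k | AwayRel s x (D.corner x 1) (D.corner x k)} = {1} from ?_] at he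
    · simp at he
    · ext k
      fin_cases k
      · simpa using fun h' => h.separated (hr h').symm
      · simpa using show AwayRel s x (D.corner x 1) (D.corner x 1) from .refl _
      · simpa using h2
      · simpa using fun h' => h.separated ((hr h').trans h30).symm
  · by_contra h2
    have he := even_ncard_corner_awayRel s x (D.corner x 0)
    rw [show {k | AwayRel s x (D.corner x 0) (D.corner x k)} = {0} from ?_] at he
    · simp at he
    · ext k
      fin_cases k
      · simpa using show AwayRel s x (D.corner x 0) (D.corner x 0) from .refl _
      · simpa using fun h' => h.separated (hr h')
      · simpa using fun h' => h.separated ((hr h').trans h12.symm)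
      · simpa using h2

include h in
theorem awayRel_of_reachable {p q : D.Pt}
    (hpq : (smoothing (Function.update s x Label.B)).Reachable p q) : AwayRel s x p q := by
  refine rel_of_smoothing_reachable (r := AwayRel s x) (Relation.EqvGen.is_equivalence _)
    (fun p q h => .rel _ _ (Or.inl h)) (fun c k l hkl => ?_) hpq
  by_cases hc : c = x
  · subst hc
    simp only [Function.update_self, smoothed] at hkl
    obtain ⟨rfl, rfl⟩ | ⟨rfl, rfl⟩ := hkl
    exacts [h.awayRel_corners.1, .symm _ _ h.awayRel_corners.2]
  · rw [Function.update_of_ne hc] at hkl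
    exact .rel _ _ (Or.inr ⟨c, k, l, hc, hkl, rfl, rfl⟩)

include h in
theorem reachable_of_update {p q : D.Pt}
    (hpq : (smoothing (Function.update s x Label.B)).Reachable p q) :
    (smoothing s).Reachable p q :=
  (h.awayRel_of_reachable hpq).reachable

include h in
theorem reachable_iff {p q : D.Pt} : (smoothing s).Reachable p q ↔
    (smoothing (Function.update s x Label.B)).Reachable p q ∨
    ((smoothing (Function.update s x Label.B)).Reachable p (D.corner x 0) ∧
      (smoothing (Function.update s x Label.B)).Reachable q (D.corner x 1)) ∨
    ((smoothing (Function.update s x Label.B)).Reachable p (D.corner x 1) ∧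
      (smoothing (Function.update s x Label.B)).Reachable q (D.corner x 0)) := by
  set G := smoothing (Function.update s x Label.B) with hG
  have h01 : (smoothing s).Reachable (D.corner x 0) (D.corner x 1) :=
    reachable_of_smoothed (by simp [smoothed, h.label])
  have h12 : G.Reachable (D.corner x 1) (D.corner x 2) :=
    reachable_of_smoothed (by simp [smoothed])
  have h30 : G.Reachable (D.corner x 3) (D.corner x 0) :=
    reachable_of_smoothed (by simp [smoothed])
  constructor
  · refine rel_of_smoothing_reachable (r := fun p q => G.Reachable p q ∨
      (G.Reachable p (D.corner x 0) ∧ G.Reachable q (D.corner x 1)) ∨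
      (G.Reachable p (D.corner x 1) ∧ G.Reachable q (D.corner x 0))) ⟨fun p => Or.inl (.refl _),
      fun {p q} hpq => ?_, fun {p q r} hpq hqr => ?_⟩
      (fun p q hpq => Or.inl (smoothing_adj.2 (Or.inl hpq)).reachable) (fun c k l hkl => ?_)
    · rcases hpq with h | h | h
      exacts [Or.inl h.symm, Or.inr (Or.inr h.symm), Or.inr (Or.inl h.symm)]
    · rcases hpq with h1 | ⟨h1, h1'⟩ | ⟨h1, h1'⟩ <;> rcases hqr with h2 | ⟨h2, h2'⟩ | ⟨h2, h2'⟩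
      · exact Or.inl (h1.trans h2)
      · exact Or.inr (Or.inl ⟨h1.trans h2, h2'⟩)
      · exact Or.inr (Or.inr ⟨h1.trans h2, h2'⟩)
      · exact Or.inr (Or.inl ⟨h1, h2.symm.trans h1'⟩)
      · exact (h.separated (h2.symm.trans h1')).elim
      · exact Or.inl (h1.trans h2'.symm)
      · exact Or.inr (Or.inr ⟨h1, h2.symm.trans h1'⟩)
      · exact Or.inl (h1.trans h2'.symm)
      · exact (h.separated (h1'.symm.trans h2)).elim
    · by_cases hc : c = x
      · subst hc
        simp only [h.label, smoothed] at hkl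
        obtain ⟨rfl, rfl⟩ | ⟨rfl, rfl⟩ := hkl
        · exact Or.inr (Or.inl ⟨.refl _, .refl _⟩)
        · exact Or.inr (Or.inr ⟨h12.symm, h30⟩)
      · refine Or.inl (reachable_of_smoothed ?_)
        rwa [Function.update_of_ne hc]
  · rintro (hpq | ⟨hp, hq⟩ | ⟨hp, hq⟩)
    · exact h.reachable_of_update hpq
    · exact ((h.reachable_of_update hp).trans h01).trans (h.reachable_of_update hq).symm
    · exact ((h.reachable_of_update hp).trans h01.symm).trans (h.reachable_of_update hq).symm

/-- The circle of `s` that contains a given circle of the state after the change at `x`. -/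
def mergeCircle (C : Circle (Function.update s x Label.B)) : Circle s :=
  C.lift (smoothing s).connectedComponentMk fun _ _ w _ =>
    SimpleGraph.ConnectedComponent.sound (h.reachable_of_update w.reachable)

include h in
theorem ncard_sdiff_eq {T : Set (Circle (Function.update s x Label.B))} {T' : Set (Circle s)}
    (hT : ∀ r, ¬ (smoothing (Function.update s x Label.B)).Reachable r (D.corner x 0) →
      ¬ (smoothing (Function.update s x Label.B)).Reachable r (D.corner x 1) →
      ((smoothing (Function.update s x Label.B)).connectedComponentMk r ∈ T ↔
        (smoothing s).connectedComponentMk r ∈ T')) :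
    (T \ {(smoothing _).connectedComponentMk (D.corner x 0),
      (smoothing _).connectedComponentMk (D.corner x 1)}).ncard =
    (T' \ {(smoothing _).connectedComponentMk (D.corner x 0)}).ncard := by
  rw [← Set.InjOn.ncard_image (f := h.mergeCircle)]
  · congr 1
    ext C
    induction C using SimpleGraph.ConnectedComponent.ind with | _ r
    simp only [Set.mem_image, Set.mem_sdiff, Set.mem_insert_iff, Set.mem_singleton_iff, not_or]
    constructor
    · rintro ⟨C, ⟨h1, h2, h3⟩, h4⟩
      induction C using SimpleGraph.ConnectedComponent.ind with | _ q
      simp only [mergeCircle, SimpleGraph.ConnectedComponent.lift_mk,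
        SimpleGraph.ConnectedComponent.eq] at h2 h3 h4
      rw [← SimpleGraph.ConnectedComponent.eq] at h4
      rw [← h4, ← hT q h2 h3, SimpleGraph.ConnectedComponent.eq, h.reachable_iff]
      refine ⟨h1, ?_⟩
      tauto
    · rintro ⟨h1, h2⟩
      rw [SimpleGraph.ConnectedComponent.eq, h.reachable_iff] at h2
      have h3 : ¬ (smoothing (Function.update s x Label.B)).Reachable r (D.corner x 1) :=
        fun h' => h2 (Or.inr (Or.inr ⟨h', .refl _⟩))
      refine ⟨(smoothing _).connectedComponentMk r, ⟨(hT r ?_ h3).2 h1, ?_, ?_⟩, rfl⟩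
      · tauto
      · rw [SimpleGraph.ConnectedComponent.eq]
        tauto
      · rwa [SimpleGraph.ConnectedComponent.eq]
  · intro C hC C' hC' he
    induction C using SimpleGraph.ConnectedComponent.ind with | _ p
    induction C' using SimpleGraph.ConnectedComponent.ind with | _ q
    simp only [Set.mem_sdiff, Set.mem_insert_iff, Set.mem_singleton_iff, not_or, mergeCircle,
      SimpleGraph.ConnectedComponent.lift_mk, SimpleGraph.ConnectedComponent.eq] at hC hC' he ⊢
    rw [h.reachable_iff] at he
    tauto

include h in
open Classical in
theorem ncard_eq {T : Set (Circle (Function.update s x Label.B))} {T' : Set (Circle s)}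
    (hT : ∀ r, ¬ (smoothing (Function.update s x Label.B)).Reachable r (D.corner x 0) →
      ¬ (smoothing (Function.update s x Label.B)).Reachable r (D.corner x 1) →
      ((smoothing (Function.update s x Label.B)).connectedComponentMk r ∈ T ↔
        (smoothing s).connectedComponentMk r ∈ T')) :
    T.ncard + (if (smoothing _).connectedComponentMk (D.corner x 0) ∈ T' then 1 else 0) =
      T'.ncard + ((if (smoothing _).connectedComponentMk (D.corner x 0) ∈ T then 1 else 0) +
        (if (smoothing _).connectedComponentMk (D.corner x 1) ∈ T then 1 else 0)) := by
  have : ∀ s : D.State, Finite (Circle s) := fun s =>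
    Finite.of_surjective (smoothing s).connectedComponentMk (fun C => C.exists_rep)
  have key : ∀ {α : Type} [Finite α] (T : Set α) (c : α),
      T.ncard = (T \ {c}).ncard + if c ∈ T then 1 else 0 := by
    intro α _ T c
    split_ifs with hc
    · exact (Set.ncard_sdiff_singleton_add_one hc).symm
    · rw [Set.sdiff_singleton_eq_self hc, add_zero]
  have h1 := h.ncard_sdiff_eq hT
  have hne : (smoothing (Function.update s x Label.B)).connectedComponentMk (D.corner x 1) ≠
      (smoothing _).connectedComponentMk (D.corner x 0) := fun he =>
    h.separated (SimpleGraph.ConnectedComponent.eq.1 he).symm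
  have h2 := key T ((smoothing _).connectedComponentMk (D.corner x 0))
  have h3 := key (T \ {(smoothing _).connectedComponentMk (D.corner x 0)})
    ((smoothing _).connectedComponentMk (D.corner x 1))
  have h4 := key T' ((smoothing _).connectedComponentMk (D.corner x 0))
  rw [Set.sdiff_sdiff, Set.singleton_union, h1] at h3
  simp only [Set.mem_sdiff, Set.mem_singleton_iff, hne, not_false_eq_true, and_true] at h3
  omega

include h in
theorem card_circle :
    Nat.card (Circle (Function.update s x Label.B)) = Nat.card (Circle s) + 1 := by
  classical
  have := h.ncard_eq (T := Set.univ) (T' := Set.univ) (by simp)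
  simp only [Set.mem_univ, if_true, Set.ncard_univ] at this
  omega

end Splits

namespace EnhancedState

/-- The sign of the circle through a point. -/
def sgn (s : D.EnhancedState) (p : D.Pt) : Sign :=
  s.sign ((smoothing s.state).connectedComponentMk p)

theorem sgn_congr {s : D.EnhancedState} {p q : D.Pt} (h : (smoothing s.state).Reachable p q) :
    s.sgn p = s.sgn q := by
  rw [sgn, sgn, SimpleGraph.ConnectedComponent.sound h]

theorem ext_of_sgn {s t : D.EnhancedState} (h : s.state = t.state) (h' : ∀ p, s.sgn p = t.sgn p) :
    s = t := by
  obtain ⟨s, e⟩ := s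
  obtain ⟨t, f⟩ := t
  obtain rfl : s = t := h
  congr 1
  ext C
  induction C using SimpleGraph.ConnectedComponent.ind with | _ p
  exact h' p

theorem sign_ne_minus {e : Sign} : e ≠ Sign.minus ↔ e = Sign.plus := by
  cases e <;> simp

theorem theta_eq (s : D.EnhancedState) : s.theta = Nat.card (Circle s.state) -
    2 * ({C | s.sign C = Sign.minus}.ncard : ℤ) := by
  have : Finite (Circle s.state) :=
    Finite.of_surjective (smoothing s.state).connectedComponentMk (fun C => C.exists_rep)
  have h := Set.ncard_add_ncard_compl {C | s.sign C = Sign.minus}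
  rw [show {C | s.sign C = Sign.minus}ᶜ = {C | s.sign C = Sign.plus} by
    ext C; simp [sign_ne_minus]] at h
  rw [theta, ← h]
  push_cast
  ring

theorem ncard_label_update {s : D.State} {x : Fin D.n} (hx : s x = Label.A) :
    {c | Function.update s x Label.B c = Label.B}.ncard = {c | s c = Label.B}.ncard + 1 := by
  rw [show {c | Function.update s x Label.B c = Label.B} = insert x {c | s c = Label.B} from ?_,
    Set.ncard_insert_of_notMem (by simp [hx])]
  ext c
  by_cases hc : c = x
  · simp [hc]
  · simp [hc]

/-- Adjacency at a crossing that splits a circle. -/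
theorem adjacentAt_iff {s t : D.EnhancedState} {x : Fin D.n} (h : Splits s.state x)
    (ht : t.state = Function.update s.state x Label.B) : AdjacentAt x s t ↔
    (∀ r, ¬ (smoothing t.state).Reachable r (D.corner x 0) →
      ¬ (smoothing t.state).Reachable r (D.corner x 1) → s.sgn r = t.sgn r) ∧
    (s.sgn (D.corner x 0) = Sign.plus ∧ t.sgn (D.corner x 0) ≠ t.sgn (D.corner x 1) ∨
     s.sgn (D.corner x 0) = Sign.minus ∧ t.sgn (D.corner x 0) = Sign.minus ∧
      t.sgn (D.corner x 1) = Sign.minus) := by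
  classical
  obtain ⟨t, f⟩ := t
  obtain rfl : t = _ := ht
  have hd : (EnhancedState.mk (Function.update s.state x Label.B) f).hdeg = s.hdeg + 1 := by
    simp only [hdeg]
    exact_mod_cast ncard_label_update h.label
  have hcommon : (∀ (C : Circle s.state) (C' : Circle (Function.update s.state x Label.B)),
      C.supp = C'.supp → s.sign C = f C') ↔
      ∀ r, ¬ (smoothing (Function.update s.state x Label.B)).Reachable r (D.corner x 0) →
      ¬ (smoothing (Function.update s.state x Label.B)).Reachable r (D.corner x 1) →
      s.sgn r = (EnhancedState.mk (Function.update s.state x Label.B) f).sgn r := by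
    constructor
    · intro hC r h0 h1
      refine hC _ _ ?_
      ext q
      simp only [SimpleGraph.ConnectedComponent.mem_supp_iff, SimpleGraph.ConnectedComponent.eq]
      rw [h.reachable_iff]
      tauto
    · intro hr C C' hC
      induction C' using SimpleGraph.ConnectedComponent.ind with | _ r
      have hmem : ∀ q, C = (smoothing s.state).connectedComponentMk q ↔
          (smoothing (Function.update s.state x Label.B)).Reachable q r := fun q => by
        rw [← SimpleGraph.ConnectedComponent.eq, eq_comm,
          ← SimpleGraph.ConnectedComponent.mem_supp_iff, hC,
          SimpleGraph.ConnectedComponent.mem_supp_iff]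
      have h01 : (smoothing s.state).connectedComponentMk (D.corner x 0) =
          (smoothing s.state).connectedComponentMk (D.corner x 1) :=
        SimpleGraph.ConnectedComponent.sound
          (reachable_of_smoothed (by simp [smoothed, h.label]))
      have h0 := hmem (D.corner x 0)
      rw [h01, hmem] at h0
      rw [(hmem r).2 (.refl _)]
      refine hr r (fun h' => ?_) (fun h' => ?_)
      · exact h.separated (h'.symm.trans (h0.2 h'.symm).symm)
      · exact h.separated ((h0.1 h'.symm).trans h')
  simp only [AdjacentAt, h.label, hd, true_and, hcommon]
  rw [and_comm]
  refine and_congr_right fun hr => ?_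
  have hn := h.ncard_eq (T := {C | f C = Sign.minus}) (T' := {C | s.sign C = Sign.minus})
    (fun r h0 h1 => by
      have := hr r h0 h1
      simp only [sgn] at this
      simp [this])
  have hc := h.card_circle
  rw [qdeg, qdeg, hd, theta_eq, theta_eq]
  simp only [sgn, hc, Set.mem_ofPred_eq] at hn ⊢
  have hs : ∀ e : Sign, e = Sign.plus ∨ e = Sign.minus := fun e => by cases e <;> simp
  rcases hs (f ((smoothing _).connectedComponentMk (D.corner x 0))) with ha | ha <;>
  rcases hs (f ((smoothing _).connectedComponentMk (D.corner x 1))) with hb | hb <;>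
  rcases hs (s.sign ((smoothing _).connectedComponentMk (D.corner x 0))) with he | he <;>
  simp [ha, hb, he] at hn ⊢ <;> omega

open Classical in
/-- The state `s`, with the sign `-` on the circles that meet `M`. -/
noncomputable def mark (s : D.State) (M : Set D.Pt) : D.EnhancedState where
  state := s
  sign C := if ∃ p ∈ M, (smoothing s).connectedComponentMk p = C then Sign.minus else Sign.plus

@[simp] theorem mark_state (s : D.State) (M : Set D.Pt) : (mark s M).state = s := rfl

theorem mark_sgn (s : D.State) (M : Set D.Pt) (q : D.Pt) :
    (mark s M).sgn q = Sign.minus ↔ ∃ p ∈ M, (smoothing s).Reachable p q := by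
  simp [sgn, mark]

theorem eq_mark_iff {t : D.EnhancedState} {M : Set D.Pt} :
    t = mark t.state M ↔
      ∀ q, t.sgn q = Sign.minus ↔ ∃ p ∈ M, (smoothing t.state).Reachable p q := by
  constructor
  · intro h q
    conv_lhs => rw [h]
    exact mark_sgn _ _ _
  · intro h
    refine ext_of_sgn rfl fun p => ?_
    have := (h p).trans (mark_sgn t.state M p).symm
    revert this
    cases t.sgn p <;> cases (mark t.state M).sgn p <;> simp

end EnhancedState
end LinkDiagram

namespace LinkDiagram

variable {D : LinkDiagram}

open EnhancedState

open Classical in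
/-- The part of the differential of an enhanced state that changes the label of `x`, up to sign. -/
noncomputable def edgeMap (x : Fin D.n) (s : D.EnhancedState) : D.Chain :=
  Finsupp.equivFunOnFinite.symm fun t => if AdjacentAt x s t then 1 else 0

/-- The sign with which the change of the label of `x` enters the differential. -/
noncomputable def edgeSign (s : D.State) (x : Fin D.n) : ℤ :=
  (-1) ^ {y | y < x ∧ s y = Label.B}.ncard

theorem differential_single (s : D.EnhancedState) :
    D.differential (Finsupp.single s 1) = ∑ x, edgeSign s.state x • edgeMap x s := by
  classical
  ext t
  rw [differential, Finsupp.linearCombination_single, one_smul, Finsupp.finsetSum_apply]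
  simp only [Finsupp.equivFunOnFinite_symm_apply_apply, incidence, Finsupp.smul_apply, edgeMap,
    edgeSign, smul_eq_mul, mul_ite, mul_one, mul_zero]

theorem edgeMap_of_label_ne {x : Fin D.n} {s : D.EnhancedState} (h : s.state x ≠ Label.A) :
    edgeMap x s = 0 := by
  ext t
  simp [edgeMap, AdjacentAt, h]

open Classical in
/-- The state `s` with the sign `-` on the circles that meet `M` and on the circle of `q`, or `0`
if that circle meets `M`. -/
noncomputable def markInsert (s : D.State) (M : Set D.Pt) (q : D.Pt) : D.Chain :=
  if ∃ p ∈ M, (smoothing s).Reachable p q then 0 else Finsupp.single (mark s (insert q M)) 1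

theorem mark_insert_congr {s : D.State} {M : Set D.Pt} {p q : D.Pt}
    (h : (smoothing s).Reachable p q) : mark s (insert p M) = mark s (insert q M) := by
  refine (eq_mark_iff (t := mark s (insert p M))).2 fun r => ?_
  rw [mark_sgn]
  simp only [Set.mem_insert_iff, exists_eq_or_imp, mark_state]
  exact or_congr_left ⟨h.symm.trans, h.trans⟩

open Classical in
theorem markInsert_congr {s : D.State} {M : Set D.Pt} {p q : D.Pt}
    (h : (smoothing s).Reachable p q) : markInsert s M p = markInsert s M q := by
  have h' : ∀ r, (smoothing s).Reachable r p ↔ (smoothing s).Reachable r q := fun r =>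
    ⟨fun hr => hr.trans h, fun hr => hr.trans h.symm⟩
  have h2 : (∃ r ∈ M, (smoothing s).Reachable r p) ↔ ∃ r ∈ M, (smoothing s).Reachable r q :=
    exists_congr fun r => and_congr_right fun _ => h' r
  rw [markInsert, markInsert, mark_insert_congr h, if_congr h2 rfl rfl]

theorem markInsert_empty (s : D.State) (p : D.Pt) :
    markInsert s ∅ p = Finsupp.single (mark s {p}) 1 := by
  simp [markInsert]

theorem edgeMap_mark {s : D.State} {x : Fin D.n} (h : Splits s x) {M : Set D.Pt}
    (hM : M.Subsingleton) : edgeMap x (mark s M) =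
      markInsert (Function.update s x Label.B) M (D.corner x 0) +
      markInsert (Function.update s x Label.B) M (D.corner x 1) := by
  classical
  ext t
  by_cases ht : t.state = Function.update s x Label.B
  swap
  · have h1 : ∀ M, mark (Function.update s x Label.B) M ≠ t := by
      rintro M rfl
      exact ht rfl
    have h2 : ∀ q, markInsert (Function.update s x Label.B) M q t = 0 := by
      intro q
      rw [markInsert]
      split_ifs
      · rfl
      · rw [Finsupp.single_eq_of_ne' (h1 _)]
    simp [h2, edgeMap, AdjacentAt, ht]
  obtain ⟨t, f⟩ := t
  obtain rfl : t = _ := ht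
  set R := (smoothing (Function.update s x Label.B)).Reachable with hR
  set t : D.EnhancedState := ⟨Function.update s x Label.B, f⟩
  have hsep : ¬ R (D.corner x 0) (D.corner x 1) := h.separated
  have hsep' : ¬ R (D.corner x 1) (D.corner x 0) := fun h' => hsep h'.symm
  have hτ : ∀ {p q}, R p q → (t.sgn p = Sign.minus ↔ t.sgn q = Sign.minus) := fun hpq => by
    rw [sgn_congr (s := t) hpq]
  have ha : ∀ {q r}, R q r → ((∃ p ∈ M, R p q) ↔ ∃ p ∈ M, R p r) := fun hqr =>
    ⟨fun ⟨p, hp, h⟩ => ⟨p, hp, h.trans hqr⟩, fun ⟨p, hp, h⟩ => ⟨p, hp, h.trans hqr.symm⟩⟩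
  have hadj := adjacentAt_iff (s := mark s M) (t := t) h rfl
  have hsgn : ∀ e e' : Sign, e = e' ↔ (e = Sign.minus ↔ e' = Sign.minus) := by
    intro e e'; cases e <;> cases e' <;> simp
  have hplus : ∀ e : Sign, e = Sign.plus ↔ ¬ e = Sign.minus := by
    intro e; cases e <;> simp
  have hs0 : (∃ p ∈ M, (smoothing s).Reachable p (D.corner x 0)) ↔
      (∃ p ∈ M, R p (D.corner x 0)) ∨ ∃ p ∈ M, R p (D.corner x 1) := by
    rw [← exists_or]
    refine exists_congr fun p => ?_
    rw [← and_or_left]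
    refine and_congr_right fun _ => ?_
    rw [h.reachable_iff]
    have := SimpleGraph.Reachable.refl (G := smoothing (Function.update s x Label.B))
      (D.corner x 0)
    tauto
  have hsr : ∀ r, ¬ R r (D.corner x 0) → ¬ R r (D.corner x 1) →
      ((∃ p ∈ M, (smoothing s).Reachable p r) ↔ ∃ p ∈ M, R p r) := by
    intro r h0 h1
    refine exists_congr fun p => and_congr_right fun _ => ?_
    rw [h.reachable_iff]
    tauto
  have hmark : ∀ q, q = D.corner x 0 ∨ q = D.corner x 1 →
      (mark (Function.update s x Label.B) (insert q M) = t ↔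
      (∀ r, ¬ R r (D.corner x 0) → ¬ R r (D.corner x 1) →
        (t.sgn r = Sign.minus ↔ ∃ p ∈ M, R p r)) ∧
      (t.sgn (D.corner x 0) = Sign.minus ↔ R q (D.corner x 0) ∨ ∃ p ∈ M, R p (D.corner x 0)) ∧
      (t.sgn (D.corner x 1) = Sign.minus ↔ R q (D.corner x 1) ∨ ∃ p ∈ M, R p (D.corner x 1))) := by
    intro q hq
    rw [eq_comm, show Function.update s x Label.B = t.state from rfl, eq_mark_iff]
    simp only [Set.mem_insert_iff, exists_eq_or_imp]
    refine ⟨fun h => ⟨fun r h0 h1 => (h r).trans (or_iff_right ?_), h _, h _⟩,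
      fun ⟨h1, h2, h3⟩ r => ?_⟩
    · rcases hq with rfl | rfl
      exacts [fun h' => h0 h'.symm, fun h' => h1 h'.symm]
    · by_cases hr0 : R r (D.corner x 0)
      · rw [hτ hr0, h2, ha hr0]
        exact or_congr_left ⟨fun h' => h'.trans hr0.symm, fun h' => h'.trans hr0⟩
      · by_cases hr1 : R r (D.corner x 1)
        · rw [hτ hr1, h3, ha hr1]
          exact or_congr_left ⟨fun h' => h'.trans hr1.symm, fun h' => h'.trans hr1⟩
        · rw [h1 r hr0 hr1]
          refine (or_iff_right ?_).symm
          rcases hq with rfl | rfl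
          exacts [fun h' => hr0 h'.symm, fun h' => hr1 h'.symm]
  have hadj' : AdjacentAt x (mark s M) t ↔
      (∀ r, ¬ R r (D.corner x 0) → ¬ R r (D.corner x 1) →
        (t.sgn r = Sign.minus ↔ ∃ p ∈ M, R p r)) ∧
      (¬ ((∃ p ∈ M, R p (D.corner x 0)) ∨ ∃ p ∈ M, R p (D.corner x 1)) ∧
        ¬ (t.sgn (D.corner x 0) = Sign.minus ↔ t.sgn (D.corner x 1) = Sign.minus) ∨
      ((∃ p ∈ M, R p (D.corner x 0)) ∨ ∃ p ∈ M, R p (D.corner x 1)) ∧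
        t.sgn (D.corner x 0) = Sign.minus ∧ t.sgn (D.corner x 1) = Sign.minus) := by
    rw [hadj]
    refine and_congr (forall_congr' fun r => forall_congr' fun h0 => forall_congr' fun h1 => ?_) ?_
    · rw [hsgn, mark_sgn, hsr r h0 h1]
      exact iff_comm
    · rw [hplus, mark_sgn, hs0, Ne, hsgn (t.sgn (D.corner x 0))]
  have hboth : ¬ ((∃ p ∈ M, R p (D.corner x 0)) ∧ ∃ p ∈ M, R p (D.corner x 1)) := by
    rintro ⟨⟨p, hp, h0⟩, q, hq, h1⟩
    obtain rfl := hM hp hq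
    exact hsep (h0.symm.trans h1)
  have hr0 : R (D.corner x 0) (D.corner x 0) := .refl _
  have hr1 : R (D.corner x 1) (D.corner x 1) := .refl _
  have h0 := hmark _ (Or.inl rfl)
  have h1 := hmark _ (Or.inr rfl)
  have hins : ∀ q, markInsert (Function.update s x Label.B) M q t =
      if (¬ ∃ p ∈ M, R p q) ∧ mark (Function.update s x Label.B) (insert q M) = t
        then 1 else 0 := by
    intro q
    rw [markInsert]
    by_cases hq : ∃ p ∈ M, R p q
    · rw [if_pos hq, if_neg (fun h' => h'.1 hq), Finsupp.zero_apply]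
    · rw [if_neg hq, Finsupp.single_apply]
      simp only [hq, not_false_eq_true, true_and]
  rw [Finsupp.add_apply, hins, hins, edgeMap, Finsupp.equivFunOnFinite_symm_apply_apply]
  simp only [h0, h1, hadj', hsep, hsep', hr0, hr1]
  generalize (∀ r, ¬ R r (D.corner x 0) → ¬ R r (D.corner x 1) →
    (t.sgn r = Sign.minus ↔ ∃ p ∈ M, R p r)) = Q
  generalize (∃ p ∈ M, R p (D.corner x 0)) = a0 at hboth ⊢
  generalize (∃ p ∈ M, R p (D.corner x 1)) = a1 at hboth ⊢
  by_cases hQ : Q <;> by_cases ha0 : a0 <;> by_cases ha1 : a1 <;> by_cases hb0 : t.sgn (D.corner x 0) = Sign.minus <;>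
    by_cases hb1 : t.sgn (D.corner x 1) = Sign.minus <;>
    simp [hQ, ha0, ha1, hb0, hb1] at hboth ⊢

open Classical in
/-- The sum of the coefficients of the enhanced states with the underlying state `u`. -/
noncomputable def coeffSum (u : D.State) : D.Chain →ₗ[ℤ] ℤ :=
  Finsupp.linearCombination ℤ fun t => if t.state = u then 1 else 0

theorem coeffSum_single (u : D.State) (t : D.EnhancedState) [Decidable (t.state = u)] :
    coeffSum u (Finsupp.single t 1) = if t.state = u then 1 else 0 := by
  simp only [coeffSum, Finsupp.linearCombination_single, one_smul]
  congr

theorem eq_mark_empty {s : D.EnhancedState} (h : s.theta = Nat.card (Circle s.state)) :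
    s = mark s.state ∅ := by
  have : Finite (Circle s.state) :=
    Finite.of_surjective (smoothing s.state).connectedComponentMk (fun C => C.exists_rep)
  rw [theta_eq] at h
  have h0 : {C | s.sign C = Sign.minus}.ncard = 0 := by omega
  rw [Set.ncard_eq_zero] at h0
  refine eq_mark_iff.2 fun q => ?_
  simp only [Set.mem_empty_iff_false, false_and, exists_false, iff_false]
  exact fun hq => (h0.subset hq : _ ∈ (∅ : Set _))

theorem even_coeffSum_differential {u : D.State}
    (hu : ∀ x, u x = Label.B → ¬ (smoothing u).Reachable (D.corner x 0) (D.corner x 1))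
    {s : D.EnhancedState} (hs : s.theta = Nat.card (Circle u) - 1) :
    Even (coeffSum u (D.differential (Finsupp.single s 1))) := by
  classical
  rw [differential_single, map_sum]
  refine Finset.even_sum _ fun x _ => ?_
  rw [map_smul, smul_eq_mul]
  refine Even.mul_left ?_ _
  by_cases hA : s.state x = Label.A
  swap
  · rw [edgeMap_of_label_ne hA, map_zero]
    exact Even.zero
  by_cases hx : Function.update s.state x Label.B = u
  · have hsp : Splits s.state x := ⟨hA, by
      rw [hx]
      exact hu x (by rw [← hx, Function.update_self])⟩
    have hc := hsp.card_circle
    rw [hx] at hc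
    rw [hc] at hs
    rw [eq_mark_empty (s := s) (by rw [hs]; push_cast; ring),
      edgeMap_mark hsp Set.subsingleton_empty, hx, map_add, markInsert_empty, markInsert_empty,
      coeffSum_single, coeffSum_single]
    simp
  · convert Even.zero
    rw [coeffSum, Finsupp.linearCombination_apply]
    refine Finset.sum_eq_zero fun t ht => ?_
    refine (congrArg _ (if_neg ?_)).trans (smul_zero _)
    rintro rfl
    rw [Finsupp.mem_support_iff] at ht
    simp only [edgeMap, Finsupp.equivFunOnFinite_symm_apply_apply, ne_eq, ite_eq_right_iff,
      one_ne_zero, imp_false, not_not] at ht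
    exact hx ht.2.1.symm

/-- Half of a boundary is a torsion class if a functional that is even on boundaries is odd
on it. -/
theorem exists_addOrderOf_eq_two_of_functional {i j : ℤ} {z y : D.Chain} (hz : z ∈ D.cycles i j)
    (hy : y ∈ D.chainsOfDegree (i - 1) j) (hyz : D.differential y = 2 • z) (φ : D.Chain →ₗ[ℤ] ℤ)
    (hφ : ∀ s : D.EnhancedState, s.hdeg = i - 1 → s.qdeg = j →
      Even (φ (D.differential (Finsupp.single s 1)))) (hφz : ¬ Even (φ z)) :
    ∃ (i j : ℤ) (x : D.KhDiagram i j), addOrderOf x = 2 := by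
  refine ⟨i, j, Submodule.Quotient.mk ⟨z, hz⟩, addOrderOf_eq_prime ?_ ?_⟩
  · rw [← Submodule.Quotient.mk_smul, Submodule.Quotient.mk_eq_zero]
    exact ⟨y, hy, hyz⟩
  · rw [Ne, Submodule.Quotient.mk_eq_zero]
    rintro ⟨y, hy, rfl : _ = z⟩
    refine hφz ?_
    rw [← Finsupp.sum_single y, Finsupp.sum, map_sum, map_sum]
    refine Finset.even_sum _ fun s hs => ?_
    have hs' := (Finsupp.mem_supported _ _).1 hy hs
    rw [show Finsupp.single s (y s) = y s • Finsupp.single s (1 : ℤ) by simp, map_smul, map_smul,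
      smul_eq_mul]
    exact (hφ s hs'.1 hs'.2).mul_left _

theorem theta_mark_empty (s : D.State) : (mark s ∅).theta = Nat.card (Circle s) := by
  rw [theta_eq]
  simp [mark]

theorem theta_mark_singleton (s : D.State) (p : D.Pt) :
    (mark s {p}).theta = Nat.card (Circle s) - 2 := by
  rw [theta_eq]
  simp only [mark, Set.mem_singleton_iff, exists_eq_left, ite_eq_left_iff, reduceCtorEq,
    imp_false, not_not]
  simp

/-! ### States with at most two labels `A` -/

/-- The state with only `B`-labels. -/
def allB : D.State := fun _ => Label.B

/-- The state whose only `A`-label is at `e`. -/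
def oneA (e : Fin D.n) : D.State := Function.update allB e Label.A

/-- The state whose only `A`-labels are at `e` and `f`. -/
def twoA (e f : Fin D.n) : D.State := Function.update (oneA e) f Label.A

theorem oneA_self (e : Fin D.n) : oneA e e = Label.A := Function.update_self _ _ _

theorem oneA_of_ne {e c : Fin D.n} (h : c ≠ e) : oneA e c = Label.B :=
  Function.update_of_ne h _ _

theorem twoA_comm {e f : Fin D.n} (h : e ≠ f) : twoA e f = twoA f e :=
  Function.update_comm h _ _ _

theorem update_oneA (e : Fin D.n) : Function.update (oneA e) e Label.B = allB := by
  rw [oneA, Function.update_idem]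
  exact Function.update_eq_self e allB

theorem update_twoA {e f : Fin D.n} (h : f ≠ e) :
    Function.update (twoA e f) f Label.B = oneA e := by
  rw [twoA, Function.update_idem, ← oneA_of_ne h, Function.update_eq_self]

theorem hdeg_mark_allB (M : Set D.Pt) : (mark allB M).hdeg = D.n := by
  simp [hdeg, allB, Set.ncard_univ]

theorem hdeg_mark_oneA (e : Fin D.n) (M : Set D.Pt) : (mark (oneA e) M).hdeg = D.n - 1 := by
  have h := ncard_label_update (oneA_self e)
  rw [update_oneA] at h
  have h' := hdeg_mark_allB M
  simp only [hdeg, mark_state] at h' ⊢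
  omega

theorem hdeg_mark_twoA {e f : Fin D.n} (hf : f ≠ e) (M : Set D.Pt) :
    (mark (twoA e f) M).hdeg = D.n - 2 := by
  have h := ncard_label_update (s := twoA e f) (x := f) (Function.update_self _ _ _)
  rw [update_twoA hf] at h
  have h' := hdeg_mark_oneA e M
  simp only [hdeg, mark_state] at h' ⊢
  omega

theorem edgeSign_oneA (e : Fin D.n) : edgeSign (oneA e) e = (-1) ^ e.val := by
  rw [edgeSign, show {y | y < e ∧ oneA e y = Label.B} = Set.Iio e from ?_]
  · rw [Set.ncard_eq_toFinset_card', Set.toFinset_Iio, Fin.card_Iio]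
  · ext y
    simp only [Set.mem_ofPred_eq, Set.mem_Iio, and_iff_left_iff_imp]
    exact fun h => oneA_of_ne h.ne

theorem edgeSign_twoA_of_lt {e f : Fin D.n} (h : f < e) :
    edgeSign (twoA e f) f = (-1) ^ f.val := by
  rw [edgeSign, show {y | y < f ∧ twoA e f y = Label.B} = Set.Iio f from ?_]
  · rw [Set.ncard_eq_toFinset_card', Set.toFinset_Iio, Fin.card_Iio]
  · ext y
    simp only [Set.mem_ofPred_eq, Set.mem_Iio, and_iff_left_iff_imp]
    intro hy
    rw [twoA, Function.update_of_ne hy.ne, oneA_of_ne (hy.trans h).ne]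

theorem edgeSign_twoA_of_gt {e f : Fin D.n} (h : e < f) :
    edgeSign (twoA e f) f = -(-1) ^ f.val := by
  have h1 : insert e {y | y < f ∧ twoA e f y = Label.B} = Set.Iio f := by
    ext y
    simp only [Set.mem_insert_iff, Set.mem_ofPred_eq, Set.mem_Iio]
    by_cases hy : y = e
    · simp [hy, h]
    · simp only [hy, false_or, and_iff_left_iff_imp]
      intro hy'
      rw [twoA, Function.update_of_ne hy'.ne, oneA_of_ne hy]
  have h2 : e ∉ {y | y < f ∧ twoA e f y = Label.B} := by
    simp [twoA, Function.update_of_ne h.ne, oneA_self]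
  have h3 := Set.ncard_insert_of_notMem h2
  rw [h1, Set.ncard_eq_toFinset_card', Set.toFinset_Iio, Fin.card_Iio] at h3
  rw [edgeSign, h3, pow_succ]
  ring

theorem differential_mark_allB (M : Set D.Pt) :
    D.differential (Finsupp.single (mark allB M) 1) = 0 := by
  rw [differential_single]
  exact Finset.sum_eq_zero fun x _ => by rw [edgeMap_of_label_ne (by simp [allB]), smul_zero]

theorem splits_oneA {e : Fin D.n}
    (h : ¬ (smoothing (allB : D.State)).Reachable (D.corner e 0) (D.corner e 1)) :
    Splits (oneA e) e :=
  ⟨oneA_self e, by rwa [update_oneA]⟩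

theorem splits_twoA {e f : Fin D.n} (hf : f ≠ e)
    (h : ¬ (smoothing (oneA e)).Reachable (D.corner f 0) (D.corner f 1)) :
    Splits (twoA e f) f :=
  ⟨Function.update_self _ _ _, by rwa [update_twoA hf]⟩

theorem differential_mark_oneA {e : Fin D.n} {M : Set D.Pt} (hM : M.Subsingleton)
    (h : ¬ (smoothing (allB : D.State)).Reachable (D.corner e 0) (D.corner e 1)) :
    D.differential (Finsupp.single (mark (oneA e) M) 1) = (-1 : ℤ) ^ e.val •
      (markInsert allB M (D.corner e 0) + markInsert allB M (D.corner e 1)) := by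
  rw [differential_single, Finset.sum_eq_single e, mark_state, edgeSign_oneA,
    edgeMap_mark (splits_oneA h) hM, update_oneA]
  · intro x _ hx
    rw [edgeMap_of_label_ne (by simp [oneA_of_ne hx]), smul_zero]
  · simp

theorem differential_mark_twoA {e f : Fin D.n} {M : Set D.Pt} (hM : M.Subsingleton) (hef : f < e)
    (he : ¬ (smoothing (oneA e)).Reachable (D.corner f 0) (D.corner f 1))
    (hf : ¬ (smoothing (oneA f)).Reachable (D.corner e 0) (D.corner e 1)) :
    D.differential (Finsupp.single (mark (twoA e f) M) 1) =
      (-1 : ℤ) ^ f.val •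
        (markInsert (oneA e) M (D.corner f 0) + markInsert (oneA e) M (D.corner f 1)) -
      (-1 : ℤ) ^ e.val •
        (markInsert (oneA f) M (D.corner e 0) + markInsert (oneA f) M (D.corner e 1)) := by
  rw [differential_single, Fintype.sum_eq_add f e hef.ne, mark_state, edgeSign_twoA_of_lt hef,
    edgeMap_mark (splits_twoA hef.ne he) hM, update_twoA hef.ne, twoA_comm hef.ne',
    edgeSign_twoA_of_gt hef, edgeMap_mark (splits_twoA hef.ne' hf) hM, update_twoA hef.ne',
    neg_smul, sub_eq_add_neg]
  · rintro x ⟨hx, hx'⟩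
    rw [edgeMap_of_label_ne, smul_zero]
    simp [twoA, Function.update_of_ne hx, oneA_of_ne hx']

end LinkDiagram

namespace LinkDiagram

variable {D : LinkDiagram}

open EnhancedState

theorem sum_alternating {A : Type*} [AddCommGroup A] (F : ℕ → A) (n : ℕ) :
    ∑ i ∈ Finset.range n, (-1 : ℤ) ^ i • (F i + F (i + 1)) = F 0 - (-1 : ℤ) ^ n • F n := by
  induction n with
  | zero => simp
  | succ n ih =>
    rw [Finset.sum_range_succ, ih, pow_succ, smul_add]
    simp only [mul_neg, mul_one, neg_smul]
    abel

theorem sum_range_sum_range_comm {A : Type*} [AddCommGroup A] (S : ℕ → ℕ → A) (k : ℕ) :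
    ∑ i ∈ Finset.range k, ∑ j ∈ Finset.range i, S j i =
      ∑ j ∈ Finset.range k, ∑ i ∈ Finset.Ico (j + 1) k, S j i :=
  Finset.sum_comm' fun i j => by
    simp only [Finset.mem_range, Finset.mem_Ico]
    omega

/-- A cycle in the all-`B` state: consecutive crossings `e 0, …, e (k - 1)` that join circles
through points `v 0, …, v k`, the last of which is on the circle of the first. -/
structure CrossingCycle (D : LinkDiagram) (k : ℕ) where
  first : ℕ
  e : ℕ → Fin D.n
  v : ℕ → D.Pt
  val_e : ∀ i < k, (e i).val = first + i
  corner_zero : ∀ i < k, D.corner (e i) 0 = v i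
  corner_one : ∀ i < k, D.corner (e i) 1 = v (i + 1)
  closed : (smoothing (allB : D.State)).Reachable (v 0) (v k)
  separated_allB : ∀ f,
    ¬ (smoothing (allB : D.State)).Reachable (D.corner f 0) (D.corner f 1)
  separated_oneA : ∀ i < k, ∀ f ≠ e i,
    ¬ (smoothing (oneA (e i))).Reachable (D.corner f 0) (D.corner f 1)

namespace CrossingCycle

variable {k : ℕ} (Z : CrossingCycle D k)
include Z

theorem exists_addOrderOf_eq_two_of_odd (hk : Odd k) :
    ∃ (i j : ℤ) (x : D.KhDiagram i j), addOrderOf x = 2 := by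
  classical
  have hs := Z.separated_allB
  refine exists_addOrderOf_eq_two_of_functional (i := D.n)
    (j := D.n + (Nat.card (Circle (allB : D.State)) - 2))
    (z := Finsupp.single (mark allB {Z.v 0}) 1)
    (y := (-1 : ℤ) ^ Z.first • ∑ i ∈ Finset.range k, Finsupp.single (mark (oneA (Z.e i)) ∅) 1)
    ⟨Finsupp.single_mem_supported _ _ ⟨hdeg_mark_allB _, ?_⟩, differential_mark_allB _⟩
    (Submodule.smul_mem _ _ (Submodule.sum_mem _ fun i _ =>
      Finsupp.single_mem_supported _ _ ⟨hdeg_mark_oneA _ _, ?_⟩)) ?_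
    (coeffSum allB) (fun s h1 h2 => even_coeffSum_differential (fun x _ => hs x) ?_) ?_
  · rw [qdeg, hdeg_mark_allB, theta_mark_singleton]
  · rw [qdeg, hdeg_mark_oneA, theta_mark_empty, ← update_oneA (Z.e i),
      (splits_oneA (hs (Z.e i))).card_circle]
    push_cast
    ring
  · rw [map_smul, map_sum]
    have h1 : ∀ i ∈ Finset.range k,
        D.differential (Finsupp.single (mark (oneA (Z.e i)) ∅) 1) = (-1 : ℤ) ^ Z.first •
          (-1 : ℤ) ^ i • (markInsert allB ∅ (Z.v i) + markInsert allB ∅ (Z.v (i + 1))) := by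
      intro i hi
      rw [Finset.mem_range] at hi
      rw [differential_mark_oneA Set.subsingleton_empty (hs _), Z.val_e i hi, Z.corner_zero i hi,
        Z.corner_one i hi, smul_smul, pow_add]
    rw [Finset.sum_congr rfl h1, ← Finset.smul_sum, smul_smul, ← pow_add, Even.neg_one_pow ⟨_, rfl⟩,
      one_smul, sum_alternating (fun i => markInsert allB ∅ (Z.v i)), hk.neg_one_pow,
      ← markInsert_congr Z.closed, markInsert_empty]
    simp only [neg_smul, one_smul, sub_neg_eq_add, two_smul]
  · rw [qdeg, h1] at h2
    linarith
  · rw [coeffSum_single, mark_state, if_pos rfl]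
    decide

theorem exists_addOrderOf_eq_two_of_even (hk : Even k) (hk0 : 0 < k) :
    ∃ (i j : ℤ) (x : D.KhDiagram i j), addOrderOf x = 2 := by
  classical
  have hs := Z.separated_allB
  have hinj : ∀ {i j}, i < k → j < k → i ≠ j → Z.e i ≠ Z.e j := fun {i j} hi hj hij h => hij <| by
    have := congrArg Fin.val h
    rw [Z.val_e _ hi, Z.val_e _ hj] at this
    omega
  have hc1 : ∀ i, Nat.card (Circle (allB : D.State)) = Nat.card (Circle (oneA (Z.e i))) + 1 :=
    fun i => by rw [← update_oneA (Z.e i), (splits_oneA (hs (Z.e i))).card_circle]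
  refine exists_addOrderOf_eq_two_of_functional (i := D.n - 1)
    (j := D.n + (Nat.card (Circle (allB : D.State)) - 4))
    (z := ∑ i ∈ Finset.range k, Finsupp.single (mark (oneA (Z.e i)) {Z.v 0}) 1)
    (y := (-1 : ℤ) ^ Z.first • ∑ i ∈ Finset.range k, ∑ j ∈ Finset.range i,
      Finsupp.single (mark (twoA (Z.e i) (Z.e j)) ∅) 1)
    ⟨Submodule.sum_mem _ fun i _ =>
      Finsupp.single_mem_supported _ _ ⟨hdeg_mark_oneA _ _, ?_⟩, ?_⟩
    (Submodule.smul_mem _ _ (Submodule.sum_mem _ fun i hi => Submodule.sum_mem _ fun j hj =>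
      Finsupp.single_mem_supported _ _ ?_)) ?_
    (coeffSum (oneA (Z.e 0)))
    (fun s h1 h2 => even_coeffSum_differential (fun x hx => Z.separated_oneA 0 hk0 x ?_) ?_) ?_
  · rw [qdeg, hdeg_mark_oneA, theta_mark_singleton, hc1 i]
    push_cast
    ring
  · rw [SetLike.mem_coe, LinearMap.mem_ker, map_sum]
    have h1 : ∀ i ∈ Finset.range k,
        D.differential (Finsupp.single (mark (oneA (Z.e i)) {Z.v 0}) 1) = (-1 : ℤ) ^ Z.first •
          (-1 : ℤ) ^ i •
            (markInsert allB {Z.v 0} (Z.v i) + markInsert allB {Z.v 0} (Z.v (i + 1))) := by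
      intro i hi
      rw [Finset.mem_range] at hi
      rw [differential_mark_oneA Set.subsingleton_singleton (hs _), Z.val_e i hi,
        Z.corner_zero i hi, Z.corner_one i hi, smul_smul, pow_add]
    rw [Finset.sum_congr rfl h1, ← Finset.smul_sum,
      sum_alternating (fun i => markInsert allB {Z.v 0} (Z.v i)), hk.neg_one_pow,
      ← markInsert_congr Z.closed, one_smul, sub_self, smul_zero]
  · rw [Finset.mem_range] at hi hj
    have hne := hinj (hj.trans hi) hi hj.ne
    have hc2 := (splits_twoA hne (Z.separated_oneA i hi _ hne)).card_circle
    rw [update_twoA hne] at hc2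
    refine ⟨(hdeg_mark_twoA hne _).trans (by ring), ?_⟩
    rw [qdeg, hdeg_mark_twoA hne, theta_mark_empty, hc1 i, hc2]
    push_cast
    ring
  · have hcl : ∀ i, (smoothing (oneA (Z.e i))).Reachable (Z.v 0) (Z.v k) := fun i =>
      (splits_oneA (hs (Z.e i))).reachable_of_update (by rw [update_oneA]; exact Z.closed)
    have hst : ∀ i < k, (smoothing (oneA (Z.e i))).Reachable (Z.v i) (Z.v (i + 1)) := by
      intro i hi
      rw [← Z.corner_zero i hi, ← Z.corner_one i hi]
      exact reachable_of_smoothed (by simp [smoothed, oneA_self])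
    let F : ℕ → ℕ → D.Chain := fun i j => markInsert (oneA (Z.e i)) ∅ (Z.v j)
    let S : ℕ → ℕ → D.Chain := fun i j => (-1 : ℤ) ^ j • (F i j + F i (j + 1))
    have h1 : ∀ i ∈ Finset.range k, ∀ j ∈ Finset.range i,
        D.differential (Finsupp.single (mark (twoA (Z.e i) (Z.e j)) ∅) 1) = (-1 : ℤ) ^ Z.first •
          (S i j - S j i) := by
      intro i hi j hj
      rw [Finset.mem_range] at hi hj
      have hj' := hj.trans hi
      have hlt : Z.e j < Z.e i := by
        rw [Fin.lt_def, Z.val_e i hi, Z.val_e j hj']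
        omega
      rw [differential_mark_twoA Set.subsingleton_empty hlt (Z.separated_oneA i hi _ hlt.ne)
        (Z.separated_oneA j hj' _ hlt.ne'), Z.val_e i hi, Z.val_e j hj', Z.corner_zero i hi,
        Z.corner_zero j hj', Z.corner_one i hi, Z.corner_one j hj', smul_sub, smul_smul, smul_smul,
        pow_add, pow_add]
    have h2 : ∀ i ∈ Finset.range k, ∑ j ∈ Finset.range i, S i j -
        ∑ j ∈ Finset.Ico (i + 1) k, S i j =
        2 • Finsupp.single (mark (oneA (Z.e i)) {Z.v 0}) 1 := by
      intro i hi
      rw [Finset.mem_range] at hi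
      rw [Finset.sum_Ico_eq_sub _ hi, sum_alternating (F i), sum_alternating (F i),
        sum_alternating (F i), hk.neg_one_pow, show F i k = F i 0 from
        (markInsert_congr (hcl i)).symm, show F i (i + 1) = F i i from
        (markInsert_congr (hst i hi)).symm, show F i 0 = _ from markInsert_empty _ _, pow_succ]
      simp only [mul_neg, mul_one, neg_smul, one_smul, two_smul]
      abel
    rw [map_smul, map_sum]
    simp only [map_sum]
    rw [Finset.sum_congr rfl fun i hi => Finset.sum_congr rfl (h1 i hi)]
    simp only [← Finset.smul_sum, Finset.sum_sub_distrib]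
    rw [sum_range_sum_range_comm S, ← Finset.sum_sub_distrib, Finset.sum_congr rfl h2, smul_smul,
      ← pow_add, Even.neg_one_pow ⟨_, rfl⟩, one_smul, Finset.smul_sum]
  · rintro rfl
    rw [oneA_self] at hx
    cases hx
  · rw [qdeg, h1] at h2
    rw [hc1 0] at h2
    push_cast at h2
    linarith
  · rw [map_sum, Finset.sum_eq_single_of_mem 0 (Finset.mem_range.2 hk0), coeffSum_single,
      mark_state, if_pos rfl]
    · decide
    · intro i hi hi0
      rw [coeffSum_single, mark_state, if_neg]
      intro h
      have := congrFun h (Z.e i)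
      rw [oneA_self, oneA_of_ne (hinj (Finset.mem_range.1 hi) hk0 hi0)] at this
      cases this

theorem exists_addOrderOf_eq_two (hk0 : 0 < k) :
    ∃ (i j : ℤ) (x : D.KhDiagram i j), addOrderOf x = 2 :=
  (Nat.even_or_odd k).elim (fun h => Z.exists_addOrderOf_eq_two_of_even h hk0)
    Z.exists_addOrderOf_eq_two_of_odd

end CrossingCycle

theorem exists_addOrderOf_eq_two_of_orientation
    (h : ∃ (i j : ℤ) (x : D.KhDiagram i j), addOrderOf x = 2) (o : D.Orientation) :
    ∃ (h q : ℤ) (x : D.Kh o h q), addOrderOf x = 2 := by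
  obtain ⟨i, j, x, hx⟩ := h
  have key : ∀ i' j', i' = i → j' = j → ∃ x : D.KhDiagram i' j', addOrderOf x = 2 := by
    rintro _ _ rfl rfl
    exact ⟨x, hx⟩
  exact ⟨i - o.negative, j + o.positive - 2 * o.negative, key _ _ (by ring) (by ring)⟩

end LinkDiagram

namespace RationalLink

open LinkDiagram

variable {w : List BraidCrossing} {cap : Fin 4 → Fin 4} {hcap : ∀ s, cap (cap s) = s}
  {hcap' : ∀ s, cap s ≠ s}

/-- The points of the strands `q` and `q + 1` on the vertical lines `l, …, r`. -/
def rectangle (w : List BraidCrossing) (l r : ℕ) (q : Fin 3) :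
    Set (Fin (w.length + 2) × Fin 4) :=
  {P | l ≤ P.1.val ∧ P.1.val ≤ r ∧ (P.2 = q.castSucc ∨ P.2 = q.succ)}

theorem cap_pair {cap : Fin 4 → Fin 4} (hcap : ∀ s, cap (cap s) = s) {q : Fin 3}
    (h : cap q.castSucc = q.succ) (x : Fin 4) :
    (x = q.castSucc ∨ x = q.succ) ↔ (cap x = q.castSucc ∨ cap x = q.succ) := by
  have h' : cap q.succ = q.castSucc := by rw [← h, hcap]
  constructor
  · rintro (rfl | rfl)
    exacts [Or.inr h, Or.inl h']
  · rintro (hx | hx) <;> rw [← hcap x, hx]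
    exacts [Or.inr h, Or.inl h']

/-- A rectangle is a union of circles if the crossings next to it are smoothed vertically and
those inside it, if they involve just one of its strands, horizontally. -/
theorem rectangle_closed {s : (plat w cap hcap hcap').State} {l r : ℕ} {q : Fin 3}
    (hl : ∀ (c : ℕ) (h : c < w.length), c + 1 = l → w[c] = ⟨q, true⟩ ∧ s ⟨c, h⟩ = Label.B)
    (hl0 : l = 0 → outerCaps q.castSucc = q.succ) (hlN : l ≤ w.length)
    (hr : ∀ (c : ℕ) (h : c < w.length), c = r → w[c] = ⟨q, true⟩ ∧ s ⟨c, h⟩ = Label.B)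
    (hr0 : w.length < r → cap q.castSucc = q.succ) (hrN : r ≠ w.length)
    (hm : ∀ (c : ℕ) (h : c < w.length), l ≤ c → c < r →
      w[c].pos = q ∨ w[c].positive = false ∧ s ⟨c, h⟩ = Label.B)
    {P Q : Fin (w.length + 2) × Fin 4} (hPQ : (smoothing s).Reachable P Q) :
    P ∈ rectangle w l r q ↔ Q ∈ rectangle w l r q := by
  refine rel_of_smoothing_reachable (D := plat w cap hcap hcap')
    (r := fun P Q => P ∈ rectangle w l r q ↔ Q ∈ rectangle w l r q)
    ⟨fun _ => Iff.rfl, Iff.symm, Iff.trans⟩ ?_ ?_ hPQ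
  · have key : ∀ P Q : Fin (w.length + 2) × Fin 4, ((Q.1.val = P.1.val + 1 ∧ Q.2 = P.2 ∧
        ∀ h : P.1.val < w.length, ¬ (w[P.1.val]).Touches P.2) ∨
        (P.1 = 0 ∧ Q.1 = 0 ∧ Q.2 = outerCaps P.2) ∨
        (P.1 = Fin.last _ ∧ Q.1 = Fin.last _ ∧ Q.2 = cap P.2)) →
        (P ∈ rectangle w l r q ↔ Q ∈ rectangle w l r q) := by
      rintro ⟨t, x⟩ ⟨t', x'⟩ (⟨h1, h2, h3⟩ | ⟨h1, h2, h3⟩ | ⟨h1, h2, h3⟩)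
      · simp only at h1 h2 h3
        subst h2
        have := t'.isLt
        simp only [rectangle, Set.mem_ofPred_eq]
        by_cases hx : x' = q.castSucc ∨ x' = q.succ
        · have h4 : t.val + 1 ≠ l := fun h4 => by
            have h5 := h3 (by omega)
            rw [(hl t.val (by omega) h4).1] at h5
            exact h5 hx
          have h5 : t.val ≠ r := fun h4 => by
            have h6 : t.val < w.length := by omega
            have h5 := h3 h6
            rw [(hr t.val h6 h4).1] at h5
            exact h5 hx
          simp only [hx, and_true]
          omega
        · simp only [hx, and_false]
      · simp only at h1 h2 h3
        subst h1 h2 h3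
        simp only [rectangle, Set.mem_ofPred_eq]
        by_cases h0 : l = 0
        · rw [cap_pair (by decide) (hl0 h0)]
        · simp [h0]
      · simp only at h1 h2 h3
        subst h1 h2 h3
        simp only [rectangle, Set.mem_ofPred_eq, Fin.val_last]
        by_cases h0 : w.length < r
        · rw [cap_pair hcap (hr0 h0)]
        · have : ¬ w.length + 1 ≤ r := by omega
          simp [this]
    intro P Q h
    obtain ⟨_, h | h⟩ := (SimpleGraph.fromRel_adj _ _ _).1 h
    exacts [key _ _ h, (key _ _ h).symm]
  · rintro ⟨c, hc⟩ k k' h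
    change c < w.length at hc
    have hl := hl c hc
    have hr := hr c hc
    have hm := hm c hc
    change platCorner w ⟨c, hc⟩ k ∈ _ ↔ platCorner w ⟨c, hc⟩ k' ∈ _
    simp only [platCorner, Fin.getElem_fin]
    generalize w[c] = g at hl hr hm
    obtain ⟨p, b⟩ := g
    simp only [BraidCrossing.mk.injEq] at hl hr hm
    generalize s ⟨c, hc⟩ = y at h hl hr hm
    by_cases hpq : p = q
    · subst hpq
      cases y <;> cases b <;> obtain ⟨rfl, rfl⟩ | ⟨rfl, rfl⟩ := h <;>
        simp [braidCorner, rectangle] at hl hr ⊢ <;> omega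
    · simp only [hpq, false_and, imp_false, false_or] at hl hr hm
      cases y <;> cases b <;> obtain ⟨rfl, rfl⟩ | ⟨rfl, rfl⟩ := h <;>
        simp [braidCorner, rectangle] at hl hr hm ⊢ <;> omega

/-- A maximal twist `l, …, r - 1` of crossings of the sign `b` on the strands `p` and `p + 1`, whose
neighbours are positive crossings on the strands `q` and `q + 1`. -/
structure IsTwist (w : List BraidCrossing) (cap : Fin 4 → Fin 4) (l r : ℕ) (p q : Fin 3)
    (b : Bool) : Prop where
  lt : l < r
  le : r ≤ w.length
  pos : p = 0 ∧ q = 1 ∨ p = 1 ∧ q = 0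
  inside : ∀ (c : ℕ) (_ : c < w.length), l ≤ c → c < r → w[c] = ⟨p, b⟩
  left : ∀ (c : ℕ) (_ : c < w.length), c + 1 = l → w[c] = ⟨q, true⟩
  left_cap : l = 0 → outerCaps q.castSucc = q.succ
  right : ∀ (c : ℕ) (_ : c < w.length), c = r → w[c] = ⟨q, true⟩
  right_cap : r = w.length → cap q.castSucc = q.succ

theorem corner_of_positive {c : ℕ} {hc : c < w.length} {p : Fin 3} (h : w[c] = ⟨p, true⟩) :
    platCorner w ⟨c, hc⟩ = ![(⟨c, by omega⟩, p.castSucc), (⟨c + 1, by omega⟩, p.castSucc),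
      (⟨c + 1, by omega⟩, p.succ), (⟨c, by omega⟩, p.succ)] := by
  funext k
  simp only [platCorner, Fin.getElem_fin, h, braidCorner, if_true]
  rfl

theorem corner_of_negative {c : ℕ} {hc : c < w.length} {p : Fin 3} (h : w[c] = ⟨p, false⟩) :
    platCorner w ⟨c, hc⟩ = ![(⟨c + 1, by omega⟩, p.castSucc), (⟨c + 1, by omega⟩, p.succ),
      (⟨c, by omega⟩, p.succ), (⟨c, by omega⟩, p.castSucc)] := by
  funext k
  simp only [platCorner, Fin.getElem_fin, h, braidCorner]
  rfl

theorem IsTwist.separated {l r : ℕ} {p q : Fin 3} (h : IsTwist w cap l r p q false)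
    {s : (plat w cap hcap hcap').State}
    (hs : ∀ (c : ℕ) (hc : c < w.length), l ≤ c + 1 → c ≤ r → s ⟨c, hc⟩ = Label.B)
    {f : ℕ} (hf : f < w.length) (hlf : l ≤ f) (hfr : f < r) :
    ¬ (smoothing s).Reachable (platCorner w ⟨f, hf⟩ 0) (platCorner w ⟨f, hf⟩ 1) := by
  have h1 := h.lt
  have h2 := h.le
  intro hR
  have := rectangle_closed (l := l) (r := if r = w.length then r + 1 else r) (q := q)
    (fun c hc h' => ⟨h.left c hc h', hs c hc (by omega) (by omega)⟩) h.left_cap (by omega)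
    (fun c hc h' => ?_) (fun h' => h.right_cap ?_) ?_ (fun c hc h3 h4 => ?_) hR
  · rw [corner_of_negative (h.inside f hf hlf hfr)] at this
    simp only [rectangle, Set.mem_ofPred_eq, Matrix.cons_val_zero, Matrix.cons_val_one] at this
    have h3 : f + 1 ≤ if r = w.length then r + 1 else r := by split_ifs <;> omega
    simp only [show l ≤ f + 1 by omega, h3, true_and] at this
    obtain ⟨rfl, rfl⟩ | ⟨rfl, rfl⟩ := h.pos <;> exact absurd this (by decide)
  · have : c = r := by split_ifs at h' <;> omega
    exact ⟨h.right c hc this, hs c hc (by omega) (by omega)⟩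
  · split_ifs at h' <;> omega
  · split_ifs <;> omega
  · have : c < r := by split_ifs at h4 <;> omega
    exact Or.inr ⟨by rw [h.inside c hc h3 this], hs c hc (by omega) (by omega)⟩

/-- Two positive crossings `c < d` on the same strands, of the same twist and smoothed vertically,
separate the strands between them from the others. -/
theorem rectangle_closed_of_twist {s : (plat w cap hcap hcap').State} {c d : ℕ} {p : Fin 3}
    (hcd : c < d) (hd : d < w.length)
    (hw : ∀ (x : ℕ) (_ : x < w.length), c ≤ x → x ≤ d → w[x] = ⟨p, true⟩)
    (hsc : s ⟨c, hcd.trans hd⟩ = Label.B) (hsd : s ⟨d, hd⟩ = Label.B)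
    {P Q : Fin (w.length + 2) × Fin 4} (hPQ : (smoothing s).Reachable P Q) :
    P ∈ rectangle w (c + 1) d p ↔ Q ∈ rectangle w (c + 1) d p := by
  refine rectangle_closed (fun x hx h => ?_) (by simp) (by omega) (fun x hx h => ?_) (by omega)
    (by omega) (fun x hx h h' => Or.inl (by rw [hw x hx (by omega) (by omega)])) hPQ
  · obtain rfl : x = c := by omega
    exact ⟨hw x hx le_rfl hcd.le, hsc⟩
  · subst h
    exact ⟨hw x hx hcd.le le_rfl, hsd⟩

/-- Every crossing has a neighbour in its twist if it is positive, and is in a twist with positive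
neighbours away from `P, …, P + k - 1` if it is negative. -/
def IsReducedAway (w : List BraidCrossing) (cap : Fin 4 → Fin 4) (P k : ℕ) : Prop :=
  ∀ (f : ℕ) (_ : f < w.length),
    (w[f].positive = true ∧ ∃ (g : ℕ) (_ : g < w.length), (g = f + 1 ∨ f = g + 1) ∧ w[g] = w[f]) ∨
    ∃ l r p q, IsTwist w cap l r p q false ∧ l ≤ f ∧ f < r ∧ (r < P ∨ P + k < l)

theorem not_reachable_corner {P k : ℕ} {p q : Fin 3} (hk : 3 ≤ k)
    (hZ : IsTwist w cap P (P + k) p q true) (hred : IsReducedAway w cap P k)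
    {s : (plat w cap hcap hcap').State} {e f : ℕ} (hPe : P ≤ e) (hek : e < P + k) (hfe : f ≠ e)
    (hs : ∀ (c : ℕ) (hc : c < w.length), c ≠ e → s ⟨c, hc⟩ = Label.B) (hf : f < w.length) :
    ¬ (smoothing s).Reachable (platCorner w ⟨f, hf⟩ 0) (platCorner w ⟨f, hf⟩ 1) := by
  have hZle := hZ.le
  have hpq : p ≠ q := by obtain ⟨rfl, rfl⟩ | ⟨rfl, rfl⟩ := hZ.pos <;> decide
  obtain ⟨hpos, g, hg, hgf, hwg⟩ | ⟨l, r, p', q', h, hlf, hfr, hlr⟩ := hred f hf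
  swap
  · exact h.separated (fun c hc h1 h2 => hs c hc (by omega)) hf hlf hfr
  obtain ⟨p', hwf⟩ : ∃ p', w[f] = ⟨p', true⟩ := ⟨w[f].pos, by rw [← hpos]⟩
  rw [hwf] at hwg
  intro hR
  rw [corner_of_positive hwf] at hR
  simp only [Matrix.cons_val_zero, Matrix.cons_val_one] at hR
  have key : ∀ {c d : ℕ} (_ : c < d) (_ : d < w.length), (c = f ∨ d = f) → c ≠ e → d ≠ e →
      (∀ (x : ℕ) (_ : x < w.length), c ≤ x → x ≤ d → w[x] = ⟨p', true⟩) → False := by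
    intro c d hcd hd hcf hce hde hw
    have := rectangle_closed_of_twist hcd hd hw (hs c _ hce) (hs d _ hde) hR
    simp only [rectangle, Set.mem_ofPred_eq, true_or, and_true] at this
    omega
  by_cases hge : g = e
  · subst hge
    have hwe := hZ.inside g hg hPe hek
    rw [hwg] at hwe
    obtain rfl : p' = p := congrArg BraidCrossing.pos hwe
    have hfP : P ≤ f := by
      by_contra hlt
      have := hZ.left f hf (by omega)
      rw [hwf] at this
      exact hpq (congrArg BraidCrossing.pos this)
    have hfk : f < P + k := by
      by_contra hlt
      have := hZ.right f hf (by omega)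
      rw [hwf] at this
      exact hpq (congrArg BraidCrossing.pos this)
    have hin : ∀ {c d : ℕ} (_ : c < d), (c = f ∨ d = f) → c ≠ g → d ≠ g → P ≤ c → d < P + k →
        False := fun {c d} h1 h2 h3 h4 h5 h6 =>
      key h1 (by omega) h2 h3 h4 fun x hx h7 h8 => hZ.inside x hx (by omega) (by omega)
    rcases hgf with hgf | hgf
    · by_cases h1 : g + 1 < P + k
      · exact hin (c := f) (d := g + 1) (by omega) (Or.inl rfl) (by omega) (by omega) hfP h1
      · exact hin (c := f - 1) (d := f) (by omega) (Or.inr rfl) (by omega) (by omega) (by omega) hfk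
    · by_cases h1 : P < g
      · exact hin (c := g - 1) (d := f) (by omega) (Or.inr rfl) (by omega) (by omega) (by omega) hfk
      · exact hin (c := f) (d := f + 1) (by omega) (Or.inl rfl) (by omega) (by omega) hfP (by omega)
  · rcases hgf with rfl | rfl
    · refine key (c := f) (d := f + 1) (by omega) hg (Or.inl rfl) hfe hge fun x hx h1 h2 => ?_
      obtain rfl | rfl : x = f ∨ x = f + 1 := by omega
      exacts [hwf, hwg]
    · refine key (c := g) (d := g + 1) (by omega) hf (Or.inr rfl) hge hfe fun x hx h1 h2 => ?_
      obtain rfl | rfl : x = g ∨ x = g + 1 := by omega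
      exacts [hwg, hwf]

/-- The point number `t` of the strand `x`. -/
def point (w : List BraidCrossing) (t : ℕ) (x : Fin 4) : Fin (w.length + 2) × Fin 4 :=
  (Fin.ofNat (w.length + 2) t, x)

theorem mk_eq_point {t : ℕ} (h : t < w.length + 2) (x : Fin 4) :
    ((⟨t, h⟩, x) : Fin (w.length + 2) × Fin 4) = point w t x := by
  rw [point, Prod.mk.injEq]
  exact ⟨Fin.ext (Nat.mod_eq_of_lt h).symm, rfl⟩

theorem reachable_of_arc {s : (plat w cap hcap hcap').State} {P Q : Fin (w.length + 2) × Fin 4}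
    (h : (Q.1.val = P.1.val + 1 ∧ Q.2 = P.2 ∧
      ∀ h : P.1.val < w.length, ¬ (w[P.1.val]).Touches P.2) ∨
      (P.1 = 0 ∧ Q.1 = 0 ∧ Q.2 = outerCaps P.2) ∨
      (P.1 = Fin.last _ ∧ Q.1 = Fin.last _ ∧ Q.2 = cap P.2)) :
    (smoothing s).Reachable P Q := by
  by_cases hPQ : P = Q
  · subst hPQ
    exact SimpleGraph.Reachable.refl _
  · have hadj : (smoothing s).Adj P Q :=
      smoothing_adj.2 (Or.inl ((SimpleGraph.fromRel_adj _ _ _).2 ⟨hPQ, Or.inl h⟩))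
    exact hadj.reachable

theorem reachable_straight {s : (plat w cap hcap hcap').State} {t : ℕ} {x : Fin 4}
    (ht : t ≤ w.length) (h : ∀ h : t < w.length, ¬ (w[t]).Touches x) :
    (smoothing s).Reachable (point w t x) (point w (t + 1) x) := by
  rw [← mk_eq_point (by omega), ← mk_eq_point (by omega)]
  exact reachable_of_arc (Or.inl ⟨rfl, rfl, h⟩)

theorem reachable_left_of_positive {c : ℕ} {p : Fin 3} (hc : c < w.length)
    (h : w[c] = ⟨p, true⟩) : (smoothing (allB : (plat w cap hcap hcap').State)).Reachable
      (point w c p.castSucc) (point w c p.succ) := by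
  have := reachable_of_smoothed (D := plat w cap hcap hcap') (s := allB) (c := ⟨c, hc⟩)
    (k := 3) (l := 0) (by simp [smoothed, allB])
  change (smoothing (allB : (plat w cap hcap hcap').State)).Reachable
    (platCorner w ⟨c, hc⟩ 3) (platCorner w ⟨c, hc⟩ 0) at this
  rw [corner_of_positive h] at this
  rw [← mk_eq_point (by omega), ← mk_eq_point (by omega)]
  exact this.symm

theorem reachable_right_of_positive {c : ℕ} {p : Fin 3} (hc : c < w.length)
    (h : w[c] = ⟨p, true⟩) : (smoothing (allB : (plat w cap hcap hcap').State)).Reachable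
      (point w (c + 1) p.castSucc) (point w (c + 1) p.succ) := by
  have := reachable_of_smoothed (D := plat w cap hcap hcap') (s := allB) (c := ⟨c, hc⟩)
    (k := 1) (l := 2) (by simp [smoothed, allB])
  change (smoothing (allB : (plat w cap hcap hcap').State)).Reachable
    (platCorner w ⟨c, hc⟩ 1) (platCorner w ⟨c, hc⟩ 2) at this
  rw [corner_of_positive h] at this
  rw [← mk_eq_point (by omega), ← mk_eq_point (by omega)]
  exact this

/-- The two ends of a positive twist with positive neighbours are on one circle. -/
theorem IsTwist.reachable_ends {l r : ℕ} {p q : Fin 3} (h : IsTwist w cap l r p q true) :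
    (smoothing (allB : (plat w cap hcap hcap').State)).Reachable
      (point w l p.castSucc) (point w r p.castSucc) := by
  have h1 := h.lt
  have h2 := h.le
  have hl := reachable_left_of_positive (cap := cap) (hcap := hcap) (hcap' := hcap')
    (by omega) (h.inside l (by omega) le_rfl h1)
  have hr := reachable_right_of_positive (cap := cap) (hcap := hcap) (hcap' := hcap')
    (by omega) (h.inside (r - 1) (by omega) (by omega) (by omega))
  rw [show r - 1 + 1 = r by omega] at hr
  have hl' : (smoothing (allB : (plat w cap hcap hcap').State)).Reachable
      (point w l q.castSucc) (point w l q.succ) := by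
    rcases Nat.eq_zero_or_pos l with h0 | h0
    · subst h0
      exact reachable_of_arc (Or.inr (Or.inl ⟨rfl, rfl, (h.left_cap rfl).symm⟩))
    · have := reachable_right_of_positive (cap := cap) (hcap := hcap) (hcap' := hcap')
        (by omega) (h.left (l - 1) (by omega) (by omega))
      rwa [show l - 1 + 1 = l by omega] at this
  have hr' : (smoothing (allB : (plat w cap hcap hcap').State)).Reachable
      (point w r q.castSucc) (point w r q.succ) := by
    rcases h2.eq_or_lt with h0 | h0
    · have hs : ∀ x, (smoothing (allB : (plat w cap hcap hcap').State)).Reachable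
          (point w r x) (point w (r + 1) x) := fun x =>
        reachable_straight h2 fun h => absurd h (by omega)
      refine (hs _).trans (.trans ?_ (hs _).symm)
      have hlast : ∀ x, point w (r + 1) x = (Fin.last _, x) := fun x => by
        rw [← mk_eq_point (by omega)]
        simp only [Prod.mk.injEq, and_true, Fin.ext_iff, Fin.val_last]
        omega
      rw [hlast, hlast]
      exact reachable_of_arc (Or.inr (Or.inr ⟨rfl, rfl, (h.right_cap h0).symm⟩))
    · exact reachable_left_of_positive h0 (h.right r h0 rfl)
  have hmid : ∀ x : Fin 4, ¬ (BraidCrossing.mk p true).Touches x → ∀ n, l + n ≤ r →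
      (smoothing (allB : (plat w cap hcap hcap').State)).Reachable
      (point w l x) (point w (l + n) x) := by
    intro x hx n
    induction n with
    | zero => exact fun _ => .refl _
    | succ n ih =>
      intro hn
      refine (ih (by omega)).trans (reachable_straight (by omega) fun h' => ?_)
      rwa [h.inside _ h' (by omega) (by omega)]
  have hmid' : ∀ x : Fin 4, ¬ (BraidCrossing.mk p true).Touches x →
      (smoothing (allB : (plat w cap hcap hcap').State)).Reachable
      (point w l x) (point w r x) := fun x hx => by
    have := hmid x hx (r - l) (by omega)
    rwa [show l + (r - l) = r by omega] at this
  obtain ⟨rfl, rfl⟩ | ⟨rfl, rfl⟩ := h.pos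
  · exact ((hl.trans hl').trans (hmid' 2 (by simp [BraidCrossing.Touches]))).trans
      (hr.trans hr').symm
  · exact (hl'.symm.trans (hmid' 0 (by simp [BraidCrossing.Touches, Fin.ext_iff]))).trans hr'

theorem plat_exists_addOrderOf_eq_two {P k : ℕ} {p q : Fin 3} (hk : 3 ≤ k)
    (hZ : IsTwist w cap P (P + k) p q true) (hred : IsReducedAway w cap P k) :
    ∃ (i j : ℤ) (x : (plat w cap hcap hcap').KhDiagram i j), addOrderOf x = 2 := by
  have hle := hZ.le
  let e : ℕ → Fin w.length := fun i => if h : P + i < w.length then ⟨P + i, h⟩ else ⟨P, by omega⟩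
  have he : ∀ i < k, ∃ h, e i = ⟨P + i, h⟩ := fun i hi =>
    ⟨by omega, dif_pos (show P + i < w.length by omega)⟩
  have hw : ∀ i (hi : i < k), w[P + i] = ⟨p, true⟩ := fun i hi =>
    hZ.inside _ _ (by omega) (by omega)
  refine CrossingCycle.exists_addOrderOf_eq_two (k := k)
    { first := P, e := e, v := fun i => point w (P + i) p.castSucc
      val_e := fun i hi => ?_, corner_zero := fun i hi => ?_, corner_one := fun i hi => ?_
      closed := hZ.reachable_ends, separated_allB := fun ⟨f, hf⟩ => ?_,
      separated_oneA := fun i hi ⟨f, hf⟩ hfe => ?_ } (by omega)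
  · obtain ⟨h, he⟩ := he i hi
    rw [he]
  · obtain ⟨h, he⟩ := he i hi
    rw [he]
    refine (congrFun (corner_of_positive (hw i hi)) 0).trans ?_
    rw [← mk_eq_point (by omega)]
    rfl
  · obtain ⟨h, he⟩ := he i hi
    rw [he]
    refine (congrFun (corner_of_positive (hw i hi)) 1).trans ?_
    rw [← mk_eq_point (by omega)]
    rfl
  · by_cases hfP : f = P
    · exact not_reachable_corner hk hZ hred (e := P + 1) (by omega) (by omega) (by omega)
        (fun _ _ _ => rfl) hf
    · exact not_reachable_corner hk hZ hred (e := P) (by omega) (by omega) hfP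
        (fun _ _ _ => rfl) hf
  · obtain ⟨h, he⟩ := he i hi
    rw [he] at hfe ⊢
    refine not_reachable_corner hk hZ hred (e := P + i) (by omega) (by omega)
      (fun h => hfe (Fin.ext h)) (fun c hc hce => oneA_of_ne fun h => hce ?_) hf
    exact congrArg Fin.val h

end RationalLink

namespace RationalLink

open LinkDiagram

variable {m : ℕ} (a : Fin m → ℤ)

/-- The crossing of which the entry number `i` consists. -/
def entryCrossing (i : Fin m) : BraidCrossing :=
  ⟨if Even i.val then 0 else 1, decide (0 < a i)⟩

/-- The number of crossings before the entry number `i`. -/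
def entryStart (i : ℕ) : ℕ :=
  (((List.finRange m).take i).flatMap fun i =>
    List.replicate (a i).natAbs (entryCrossing a i)).length

theorem entryStart_zero : entryStart a 0 = 0 := by simp [entryStart]

theorem entryStart_last : entryStart a m = (braidWord a).length := by
  rw [entryStart, List.take_of_length_le (by simp)]
  rfl

theorem entryStart_succ (i : Fin m) :
    entryStart a (i.val + 1) = entryStart a i + (a i).natAbs := by
  rw [entryStart, List.take_succ_eq_append_getElem (by simp), List.flatMap_append,
    List.length_append]
  simp [entryStart]

theorem entryStart_le {i j : ℕ} (h : i ≤ j) : entryStart a i ≤ entryStart a j := by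
  rw [entryStart, entryStart, ← List.take_append_drop i ((List.finRange m).take j),
    List.take_take, min_eq_left h, List.flatMap_append, List.length_append]
  omega

theorem braidWord_getElem {i : Fin m} {c : ℕ} (hc : c < (braidWord a).length)
    (h1 : entryStart a i ≤ c) (h2 : c < entryStart a (i.val + 1)) :
    (braidWord a)[c] = entryCrossing a i := by
  have hw : braidWord a = (((List.finRange m).take (i.val + 1)).flatMap fun i =>
      List.replicate (a i).natAbs (entryCrossing a i)) ++
      (((List.finRange m).drop (i.val + 1)).flatMap fun i =>
      List.replicate (a i).natAbs (entryCrossing a i)) := by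
    rw [← List.flatMap_append, List.take_append_drop]
    rfl
  have hw' : (((List.finRange m).take (i.val + 1)).flatMap fun i =>
      List.replicate (a i).natAbs (entryCrossing a i)) =
      (((List.finRange m).take i).flatMap fun i =>
      List.replicate (a i).natAbs (entryCrossing a i)) ++
      List.replicate (a i).natAbs (entryCrossing a i) := by
    rw [List.take_succ_eq_append_getElem (by simp), List.flatMap_append]
    simp
  simp only [hw, hw']
  rw [List.getElem_append_left, List.getElem_append_right h1, List.getElem_replicate]
  rwa [← hw']

theorem exists_entry {c : ℕ} (hc : c < (braidWord a).length) :
    ∃ i : Fin m, entryStart a i ≤ c ∧ c < entryStart a (i.val + 1) := by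
  have h : ∀ j ≤ m, c < entryStart a j →
      ∃ i : Fin m, entryStart a i ≤ c ∧ c < entryStart a (i.val + 1) := by
    intro j
    induction j with
    | zero => simp [entryStart_zero]
    | succ j ih =>
      intro hj hcj
      rcases lt_or_ge c (entryStart a j) with h | h
      · exact ih (by omega) h
      · exact ⟨⟨j, hj⟩, h, hcj⟩
  exact h m le_rfl (by rwa [entryStart_last])

variable {a} (hzero : ∀ i, a i ≠ 0)
include hzero

theorem isTwist_entry (i : Fin m)
    (hi : ∀ k : Fin m, (k.val = i.val + 1 ∨ i.val = k.val + 1) → 0 < a k) :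
    IsTwist (braidWord a) (if Even m then sideCaps else outerCaps)
      (entryStart a i) (entryStart a (i.val + 1))
      (if Even i.val then 0 else 1) (if Even i.val then 1 else 0) (decide (0 < a i)) := by
  have hlt : ∀ i : Fin m, entryStart a i < entryStart a (i.val + 1) := fun i => by
    rw [entryStart_succ]
    have := Int.natAbs_pos.2 (hzero i)
    omega
  have hpos : ∀ k : Fin m, (k.val = i.val + 1 ∨ i.val = k.val + 1) →
      entryCrossing a k = ⟨if Even i.val then 1 else 0, true⟩ := by
    intro k hk
    rw [entryCrossing, decide_eq_true (hi k hk)]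
    rcases hk with hk | hk
    · by_cases he : Even i.val <;> simp [hk, he, Nat.even_add_one]
    · by_cases he : Even k.val <;> simp [hk, he, Nat.even_add_one]
  refine ⟨hlt i, ?_, ?_, fun c hc h1 h2 => braidWord_getElem a hc h1 h2, fun c hc h => ?_,
    fun h => ?_, fun c hc h => ?_, fun h => ?_⟩
  · rw [← entryStart_last]
    exact entryStart_le a i.isLt
  · split_ifs <;> simp
  · have hi0 : i.val ≠ 0 := fun h0 => by
      rw [h0, entryStart_zero] at h
      omega
    have h1 : i.val - 1 + 1 = i.val := by omega
    have h2 := hlt ⟨i.val - 1, by omega⟩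
    simp only [h1] at h2
    rw [← hpos ⟨i.val - 1, by omega⟩ (by simp only; omega)]
    refine braidWord_getElem a hc (by simp only; omega) ?_
    simp only [h1]
    omega
  · have hi0 : i.val = 0 := by
      by_contra h0
      have h1 : i.val - 1 + 1 = i.val := by omega
      have h2 := hlt ⟨i.val - 1, by omega⟩
      simp only [h1] at h2
      omega
    simp only [hi0]
    decide
  · have him : i.val + 1 < m := by
      by_contra h0
      rw [show i.val + 1 = m by omega, entryStart_last] at h
      omega
    rw [← hpos ⟨i.val + 1, him⟩ (Or.inl rfl)]
    exact braidWord_getElem a hc h.ge (h ▸ hlt ⟨i.val + 1, him⟩)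
  · have him : i.val + 1 = m := by
      by_contra h0
      have him : i.val + 1 < m := by omega
      have h1 := hlt ⟨i.val + 1, him⟩
      have h2 := entryStart_le a (show i.val + 1 + 1 ≤ m by omega)
      rw [entryStart_last] at h2
      simp only at h1
      omega
    have he := Nat.even_add_one (n := i.val)
    rw [him] at he
    by_cases hi : Even i.val
    · simp only [he, hi, not_true, if_true, if_false]
      decide
    · simp only [he, hi, not_false_eq_true, if_true, if_false]
      decide

theorem isReducedAway_entry (hone : ∀ i, a i ≠ 1) (j : Fin m) (hj : 3 ≤ a j)
    (hjpos : ∀ k : Fin m, (k.val = j.val + 1 ∨ j.val = k.val + 1) → 0 < a k)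
    (hneg : ∀ i, a i < 0 →
      ∀ k : Fin m, (k.val = i.val + 1 ∨ i.val = k.val + 1) → 0 < a k) :
    IsReducedAway (braidWord a) (if Even m then sideCaps else outerCaps)
      (entryStart a j) (a j).natAbs := by
  intro f hf
  obtain ⟨i, h1, h2⟩ := exists_entry a hf
  have hle : entryStart a (i.val + 1) ≤ (braidWord a).length := by
    rw [← entryStart_last]
    exact entryStart_le a i.isLt
  have hsucc := entryStart_succ a i
  rw [braidWord_getElem a hf h1 h2]
  by_cases hi : 0 < a i
  · refine Or.inl ⟨decide_eq_true hi, ?_⟩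
    have := hone i
    by_cases hfi : f + 1 < entryStart a (i.val + 1)
    · exact ⟨f + 1, by omega, Or.inl rfl, braidWord_getElem a _ (by omega) hfi⟩
    · exact ⟨f - 1, by omega, Or.inr (by omega), braidWord_getElem a _ (by omega) (by omega)⟩
  · have hi' : a i < 0 := lt_of_le_of_ne (not_lt.1 hi) (hzero i)
    have ht := isTwist_entry hzero i (hneg i hi')
    rw [decide_eq_false hi] at ht
    refine Or.inr ⟨_, _, _, _, ht, h1, h2, ?_⟩
    have hij : i ≠ j := by
      rintro rfl
      omega
    have hij1 : j.val ≠ i.val + 1 := fun h => hi (hjpos i (Or.inr h))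
    have hij2 : i.val ≠ j.val + 1 := fun h => hi (hjpos i (Or.inl h))
    have hij3 : i.val ≠ j.val := fun h => hij (Fin.ext h)
    rw [← entryStart_succ]
    have hlt : ∀ (x y : ℕ), x < y → y ≤ m → entryStart a x < entryStart a y := by
      intro x y hxy hy
      have h3 := entryStart_succ a ⟨x, by omega⟩
      have h4 := entryStart_le a (show x + 1 ≤ y from hxy)
      have := Int.natAbs_pos.2 (hzero ⟨x, by omega⟩)
      simp only at h3
      omega
    have := i.isLt
    have := j.isLt
    rcases lt_or_gt_of_ne hij3 with h | h
    · exact Or.inl (hlt _ _ (by omega) (by omega))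
    · exact Or.inr (hlt _ _ (by omega) (by omega))

end RationalLink

theorem mainTheorem9 {m : ℕ} (a : Fin m → ℤ)
    (hzero : ∀ i, a i ≠ 0)
    (hone : ∀ i, a i ≠ 1)
    (hlarge : ∃ j, 3 ≤ a j ∧
      ∀ k : Fin m, (k.val = j.val + 1 ∨ j.val = k.val + 1) → 0 < a k)
    (hneg : ∀ i, a i < 0 →
      ∀ k : Fin m, (k.val = i.val + 1 ∨ i.val = k.val + 1) → 0 < a k) :
    (∃ (i j : ℤ) (x : (RationalLink.diagram a).KhDiagram i j), addOrderOf x = 2) ∧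
    ∀ o : (RationalLink.diagram a).Orientation,
      ∃ (h q : ℤ) (x : (RationalLink.diagram a).Kh o h q), addOrderOf x = 2 := by
  obtain ⟨j, hj, hjpos⟩ := hlarge
  have ht := RationalLink.isTwist_entry hzero j hjpos
  rw [RationalLink.entryStart_succ, decide_eq_true (by omega)] at ht
  have h : ∃ (i j : ℤ) (x : (RationalLink.diagram a).KhDiagram i j), addOrderOf x = 2 :=
    RationalLink.plat_exists_addOrderOf_eq_two (by omega) ht
      (RationalLink.isReducedAway_entry hzero hone j hj hjpos hneg)
  exact ⟨h, LinkDiagram.exists_addOrderOf_eq_two_of_orientation h⟩
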